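/- Let $p\in(0,3/4]$ and $q\in(0,1]$. Let $(X_n)_{n\ge1}$ be the steps of the elephant random walk with memory parameter $p$ and first-step parameter $q$: $\mathbf P(X_1=1)=q$, $\mathbf P(X_1=-1)=1-q$, and for every $n\ge1$, $X_{n+1}=\alpha_{n+1}X_{\beta_{n+1}}$, where $\alpha_{n+1}$, $\beta_{n+1}$ and $(X_1,\dots,X_n)$ are independent, $\mathbf P(\alpha_{n+1}=1)=p$, $\mathbf P(\alpha_{n+1}=-1)=1-p$, and $\beta_{n+1}$ is uniformly distributed on $\{1,\dots,n\}$. Put $T_n=\sum_{i=1}^nX_i$, $$a_n=\frac{\Gamma(n)\,\Gamma(2p)}{\Gamma(n+2p-1)}\ \ (\text{so } a_1=1),\qquad v_n=\sum_{i=1}^na_i^2,$$ and, for a real random variable $Y$, $\mathbf K(Y)=\sup_{u\in\mathbb R}|\mathbf P(Y\le u)-\Phi(u)|$, where $\Phi$ is the standard normal distribution function. Then there is a constant $C>0$ depending only on $p$ and $q$ such that for all $n\ge1$, $$\mathbf K\!\left(\frac{a_nT_n-(2q-1)}{\sqrt{v_n}}\right)\le C\left(\frac1{\sqrt n}+\frac1{v_n}\right).$$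 Moreover, for all $n\ge1$, the left-hand side is at most $C/\sqrt n$ if $p\le5/8$, and at most $C/v_n$ if $p>5/8$. -/

import Mathlib

open MeasureTheory ProbabilityTheory

/-- `IsElephantWalk μ p q X α β`: on the probability space `(Ω, μ)`, the sequence `X 1, X 2, …` is
the sequence of steps of the elephant random walk with memory parameter `p` and first-step
parameter `q`. The variable `β (n + 1)` is the time in `{1, …, n}` that the elephant remembers at
time `n + 1`, and the sign `α (n + 1)` says whether the remembered step is repeated or reversed.
(The values `X 0`, `α 0`, `α 1`, `β 0`, `β 1` play no role.) -/
structure IsElephantWalk {Ω : Type*} [MeasurableSpace Ω] (μ : Measure Ω) (p q : ℝ)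
    (X α : ℕ → Ω → ℝ) (β : ℕ → Ω → ℕ) : Prop where
  measurable_step : ∀ n, Measurable (X n)
  measurable_sign : ∀ n, Measurable (α n)
  measurable_memory : ∀ n, Measurable (β n)
  /-- The first step is `1` with probability `q` and `-1` with probability `1 - q`. -/
  first_step_pos : μ.real {ω | X 1 ω = 1} = q
  first_step_neg : μ.real {ω | X 1 ω = -1} = 1 - q
  /-- The sign is `1` with probability `p` and `-1` with probability `1 - p`. -/
  sign_pos : ∀ n, 1 ≤ n → μ.real {ω | α (n + 1) ω = 1} = p
  sign_neg : ∀ n, 1 ≤ n → μ.real {ω | α (n + 1) ω = -1} = 1 - p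
  /-- The remembered time is uniformly distributed on `{1, …, n}`. -/
  memory_uniform : ∀ n, 1 ≤ n → ∀ k ∈ Finset.Icc 1 n, μ.real {ω | β (n + 1) ω = k} = 1 / (n : ℝ)
  /-- The sign, the remembered time and the past steps `(X 1, …, X n)` are independent. -/
  indep_sign_memory : ∀ n, 1 ≤ n → IndepFun (α (n + 1)) (β (n + 1)) μ
  indep_past : ∀ n, 1 ≤ n →
    IndepFun (fun ω => (α (n + 1) ω, β (n + 1) ω)) (fun ω (i : Finset.Icc 1 n) => X i ω) μ
  /-- The dynamics of the walk. -/
  step_succ : ∀ n, 1 ≤ n → ∀ᵐ ω ∂μ, X (n + 1) ω = α (n + 1) ω * X (β (n + 1) ω) ω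

/-- The position `T_n = X_1 + ⋯ + X_n` at time `n`. -/
def elephantPosition {Ω : Type*} (X : ℕ → Ω → ℝ) (n : ℕ) (ω : Ω) : ℝ :=
  ∑ i ∈ Finset.Icc 1 n, X i ω

/-- The normalizing sequence `a_n = Γ(n) Γ(2p) / Γ(n + 2p - 1)`, used for `n ≥ 1` and `p > 0`. -/
noncomputable def elephantA (p : ℝ) (n : ℕ) : ℝ :=
  Real.Gamma n * Real.Gamma (2 * p) / Real.Gamma (n + 2 * p - 1)

/-- The formula agrees with the convention `a_1 = 1`. -/
theorem elephantA_one (p : ℝ) (hp : 0 < p) : elephantA p 1 = 1 := by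
  have h : Real.Gamma (2 * p) ≠ 0 := (Real.Gamma_pos_of_pos (by linarith)).ne'
  have e : ((1 : ℕ) : ℝ) + 2 * p - 1 = 2 * p := by push_cast; ring
  rw [elephantA, e, Nat.cast_one, Real.Gamma_one, one_mul, div_self h]

/-- `v_n = a_1 ^ 2 + ⋯ + a_n ^ 2`. -/
noncomputable def elephantV (p : ℝ) (n : ℕ) : ℝ :=
  ∑ i ∈ Finset.Icc 1 n, elephantA p i ^ 2

/-- The Kolmogorov distance `sup_u |P(Y ≤ u) - Φ(u)|` between the law of `Y` and the standard normal
distribution. (For a probability measure the supremum is over a set bounded by `1`.) -/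
noncomputable def kolmogorovDist {Ω : Type*} [MeasurableSpace Ω] (μ : Measure Ω) (Y : Ω → ℝ) : ℝ :=
  ⨆ u : ℝ, |μ.real {ω | Y ω ≤ u} - cdf (gaussianReal 0 1) u|

open Filter Topology

/-- The Fejér kernel `4 sin² (u / 2) / u²`. -/
noncomputable def fejerKernel (u : ℝ) : ℝ := Real.sinc (u / 2) ^ 2

theorem continuous_fejerKernel : Continuous fejerKernel := by
  unfold fejerKernel
  have := Real.continuous_sinc
  fun_prop

theorem fejerKernel_nonneg (u : ℝ) : 0 ≤ fejerKernel u := sq_nonneg _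

theorem fejerKernel_of_ne_zero {u : ℝ} (hu : u ≠ 0) :
    fejerKernel u = 2 * (1 - Real.cos u) / u ^ 2 := by
  have h : Real.cos u = 1 - 2 * Real.sin (u / 2) ^ 2 := by
    have := Real.cos_two_mul (u / 2)
    have h2 := Real.sin_sq_add_cos_sq (u / 2)
    rw [show 2 * (u / 2) = u by ring] at this
    linarith
  rw [fejerKernel, Real.sinc_of_ne_zero (by positivity), h]
  field_simp
  ring

theorem fejerKernel_le (u : ℝ) : fejerKernel u ≤ 5 * (1 + u ^ 2)⁻¹ := by
  have h1 : fejerKernel u ≤ 1 := by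
    unfold fejerKernel
    have := Real.abs_sinc_le_one (u / 2)
    rw [← sq_abs]
    exact pow_le_one₀ (abs_nonneg _) this
  have h2 : fejerKernel u * u ^ 2 ≤ 4 := by
    rcases eq_or_ne u 0 with rfl | hu
    · norm_num
    · rw [fejerKernel_of_ne_zero hu, div_mul_cancel₀ _ (by positivity)]
      linarith [Real.neg_one_le_cos u]
  rw [← div_eq_mul_inv, le_div_iff₀ (by positivity)]
  linarith

theorem integrable_fejerKernel : Integrable fejerKernel := by
  refine (integrable_inv_one_add_sq.const_mul 5).mono'
    continuous_fejerKernel.aestronglyMeasurable (ae_of_all _ fun u => ?_)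
  rw [Real.norm_of_nonneg (fejerKernel_nonneg u)]
  exact fejerKernel_le u

theorem integral_fejerKernel_pos : 0 < ∫ u, fejerKernel u := by
  refine (integral_pos_iff_support_of_nonneg fejerKernel_nonneg integrable_fejerKernel).2 ?_
  refine (continuous_fejerKernel.isOpen_support).measure_pos volume ⟨0, ?_⟩
  simp [fejerKernel]

theorem fejerKernel_eq_integral (u : ℝ) :
    (fejerKernel u : ℂ) =
      ∫ t in (-1 : ℝ)..1, ((1 - |t| : ℝ) : ℂ) * Complex.exp (t * u * Complex.I) := by
  have hcont : Continuous fun t : ℝ => ((1 - |t| : ℝ) : ℂ) * Complex.exp (t * u * Complex.I) := by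
    fun_prop
  rw [← intervalIntegral.integral_add_adjacent_intervals (b := 0)
    (hcont.intervalIntegrable _ _) (hcont.intervalIntegrable _ _)]
  rcases eq_or_ne u 0 with rfl | hu
  · have e1 : ∫ t in (-1 : ℝ)..0, ((1 - |t| : ℝ) : ℂ) * Complex.exp (t * (0 : ℝ) * Complex.I)
        = ((∫ t in (-1 : ℝ)..0, (1 + t) : ℝ) : ℂ) := by
      rw [← intervalIntegral.integral_ofReal]
      refine intervalIntegral.integral_congr fun t ht => ?_
      rw [Set.uIcc_of_le (by norm_num)] at ht
      simp [abs_of_nonpos ht.2]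
    have e2 : ∫ t in (0 : ℝ)..1, ((1 - |t| : ℝ) : ℂ) * Complex.exp (t * (0 : ℝ) * Complex.I)
        = ((∫ t in (0 : ℝ)..1, (1 - t) : ℝ) : ℂ) := by
      rw [← intervalIntegral.integral_ofReal]
      refine intervalIntegral.integral_congr fun t ht => ?_
      rw [Set.uIcc_of_le (by norm_num)] at ht
      simp [abs_of_nonneg ht.1]
    have e3 : ∫ t in (-1 : ℝ)..0, (1 + t) = 1 / 2 := by
      rw [intervalIntegral.integral_add (by simp) (by simp), integral_id]
      norm_num
    have e4 : ∫ t in (0 : ℝ)..1, (1 - t) = 1 / 2 := by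
      rw [intervalIntegral.integral_sub (by simp) (by simp), integral_id]
      norm_num
    rw [e1, e2, e3, e4]
    simp [fejerKernel]
    norm_num
  · have hu' : (u : ℂ) ≠ 0 := by exact_mod_cast hu
    have hI := Complex.I_ne_zero
    have hexp : ∀ t : ℝ, HasDerivAt (fun t : ℝ => Complex.exp (t * u * Complex.I))
        (Complex.exp (t * u * Complex.I) * (u * Complex.I)) t := fun t => by
      have h1 : HasDerivAt (fun t : ℝ => (t : ℂ)) 1 t := Complex.ofRealCLM.hasDerivAt
      simpa using ((h1.mul_const (u : ℂ)).mul_const Complex.I).cexp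
    have hid : ∀ t : ℝ, HasDerivAt (fun t : ℝ => (t : ℂ)) 1 t :=
      fun t => Complex.ofRealCLM.hasDerivAt
    have e1 : ∫ t in (-1 : ℝ)..0, ((1 - |t| : ℝ) : ℂ) * Complex.exp (t * u * Complex.I)
        = ∫ t in (-1 : ℝ)..0, (1 + (t : ℂ)) * Complex.exp (t * u * Complex.I) := by
      refine intervalIntegral.integral_congr fun t ht => ?_
      rw [Set.uIcc_of_le (by norm_num)] at ht
      simp [abs_of_nonpos ht.2]
    have e2 : ∫ t in (0 : ℝ)..1, ((1 - |t| : ℝ) : ℂ) * Complex.exp (t * u * Complex.I)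
        = ∫ t in (0 : ℝ)..1, (1 - (t : ℂ)) * Complex.exp (t * u * Complex.I) := by
      refine intervalIntegral.integral_congr fun t ht => ?_
      rw [Set.uIcc_of_le (by norm_num)] at ht
      simp [abs_of_nonneg ht.1]
    rw [e1, e2]
    rw [intervalIntegral.integral_eq_sub_of_hasDerivAt
      (f := fun t : ℝ => (1 + (t : ℂ)) * Complex.exp (t * u * Complex.I) / (u * Complex.I)
        - Complex.exp (t * u * Complex.I) / (u * Complex.I) ^ 2)
      (fun t _ => ?_) (Continuous.intervalIntegrable (by fun_prop) _ _)]
    rw [intervalIntegral.integral_eq_sub_of_hasDerivAt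
      (f := fun t : ℝ => (1 - (t : ℂ)) * Complex.exp (t * u * Complex.I) / (u * Complex.I)
        + Complex.exp (t * u * Complex.I) / (u * Complex.I) ^ 2)
      (fun t _ => ?_) (Continuous.intervalIntegrable (by fun_prop) _ _)]
    · rw [fejerKernel_of_ne_zero hu]
      push_cast
      rw [Complex.cos]
      rw [mul_pow, Complex.I_sq]
      simp only [zero_mul, Complex.exp_zero, one_mul, neg_mul, add_neg_cancel, sub_self, zero_div]
      field_simp
      ring
    · have := ((((hid t).const_sub 1).mul (hexp t)).div_const (u * Complex.I)).add
        ((hexp t).div_const ((u * Complex.I) ^ 2))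
      refine this.congr_deriv ?_
      field_simp
      ring
    · have := ((((hid t).const_add 1).mul (hexp t)).div_const (u * Complex.I)).sub
        ((hexp t).div_const ((u * Complex.I) ^ 2))
      refine this.congr_deriv ?_
      field_simp
      ring

theorem norm_integral_exp_mul_I_le (t a b : ℝ) (ht : t ≠ 0) :
    ‖∫ z in a..b, Complex.exp (t * z * Complex.I)‖ ≤ 2 / |t| := by
  have h : (t : ℂ) * Complex.I ≠ 0 := by simp [ht]
  have e : ∀ z : ℝ, Complex.exp (t * z * Complex.I) = Complex.exp (t * Complex.I * z) := by
    intro z; ring_nf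
  simp_rw [e]
  rw [integral_exp_mul_complex h, norm_div]
  have h1 : ‖(t : ℂ) * Complex.I‖ = |t| := by simp
  rw [h1]
  gcongr
  refine (norm_sub_le _ _).trans ?_
  have h2 : ∀ z : ℝ, ‖Complex.exp (t * Complex.I * z)‖ = 1 := fun z => by
    rw [show (t : ℂ) * Complex.I * z = ((t * z : ℝ) : ℂ) * Complex.I by push_cast; ring]
    exact Complex.norm_exp_ofReal_mul_I _
  rw [h2, h2]
  norm_num

/-- The mass that the convolution of `μ` with the Fejér kernel gives to `(a, b]`, in terms of the
characteristic function of `μ`. -/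
theorem integral_integral_fejerKernel_eq_charFun (μ : Measure ℝ) [IsProbabilityMeasure μ]
    {a b : ℝ} (hab : a ≤ b) :
    ((∫ y, (∫ z in a..b, fejerKernel (z - y)) ∂μ : ℝ) : ℂ) =
      ∫ t in (-1 : ℝ)..1, ((1 - |t| : ℝ) : ℂ) *
        (∫ z in a..b, Complex.exp (t * z * Complex.I)) * charFun μ (-t) := by
  have h11 : (-1 : ℝ) ≤ 1 := by norm_num
  have step1 : ∀ y : ℝ, ((∫ z in a..b, fejerKernel (z - y) : ℝ) : ℂ) =
      ∫ t in (-1 : ℝ)..1, ((1 - |t| : ℝ) : ℂ) *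
        (∫ z in a..b, Complex.exp (t * z * Complex.I)) * Complex.exp (-t * y * Complex.I) := by
    intro y
    rw [← intervalIntegral.integral_ofReal]
    simp_rw [fejerKernel_eq_integral, intervalIntegral.integral_of_le h11,
      intervalIntegral.integral_of_le hab]
    rw [integral_integral_swap]
    · refine integral_congr_ae (ae_of_all _ fun t => ?_)
      simp only
      rw [mul_assoc, ← integral_mul_const, ← integral_const_mul]
      refine integral_congr_ae (ae_of_all _ fun z => ?_)
      simp only
      rw [← Complex.exp_add]
      congr 2
      push_cast
      ring
    · have hc : Continuous (Function.uncurry fun (z t : ℝ) =>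
          ((1 - |t| : ℝ) : ℂ) * Complex.exp (t * ((z - y : ℝ) : ℂ) * Complex.I)) := by
        unfold Function.uncurry
        fun_prop
      rw [Measure.prod_restrict]
      refine IntegrableOn.mono_set (t := Set.Icc a b ×ˢ Set.Icc (-1) 1) ?_
        (Set.prod_mono Set.Ioc_subset_Icc_self Set.Ioc_subset_Icc_self)
      exact hc.continuousOn.integrableOn_compact (isCompact_Icc.prod isCompact_Icc)
  rw [← integral_complex_ofReal]
  simp_rw [step1, intervalIntegral.integral_of_le h11]
  have hQ : Continuous fun t : ℝ => ∫ z in a..b, Complex.exp (t * z * Complex.I) := by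
    refine intervalIntegral.continuous_parametric_intervalIntegral_of_continuous' ?_ a b
    unfold Function.uncurry
    fun_prop
  rw [integral_integral_swap]
  · refine integral_congr_ae (ae_of_all _ fun t => ?_)
    simp only
    rw [integral_const_mul, charFun_apply_real]
    push_cast
    rfl
  · have hc : Continuous (Function.uncurry fun (y t : ℝ) =>
        ((1 - |t| : ℝ) : ℂ) * (∫ z in a..b, Complex.exp (t * z * Complex.I)) *
          Complex.exp (-t * y * Complex.I)) := by
      unfold Function.uncurry
      have := hQ.comp (continuous_snd (X := ℝ) (Y := ℝ))
      simp only [Function.comp_def] at this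
      fun_prop
    refine Integrable.of_bound (hc.aestronglyMeasurable) (b - a) ?_
    have hs : ∀ᵐ x ∂(μ.prod (volume.restrict (Set.Ioc (-1 : ℝ) 1))), x.2 ∈ Set.Ioc (-1 : ℝ) 1 :=
      Measure.quasiMeasurePreserving_snd.ae (ae_restrict_mem measurableSet_Ioc)
    filter_upwards [hs] with x hx
    have h1 : ‖∫ z in a..b, Complex.exp (x.2 * z * Complex.I)‖ ≤ b - a := by
      have := intervalIntegral.norm_integral_le_of_norm_le_const (a := a) (b := b)
        (f := fun z : ℝ => Complex.exp (x.2 * z * Complex.I)) (C := 1) (fun z _ => by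
          rw [← Complex.ofReal_mul, Complex.norm_exp_ofReal_mul_I])
      rwa [one_mul, abs_of_nonneg (by linarith)] at this
    have h2 : ‖Complex.exp (-(x.2 : ℂ) * x.1 * Complex.I)‖ = 1 := by
      rw [← Complex.ofReal_neg, ← Complex.ofReal_mul, Complex.norm_exp_ofReal_mul_I]
    have h3 : ‖((1 - |x.2| : ℝ) : ℂ)‖ ≤ 1 := by
      rw [Complex.norm_real, Real.norm_eq_abs, abs_le]
      have : |x.2| ≤ 1 := abs_le.2 ⟨hx.1.le, hx.2⟩
      constructor <;> linarith [abs_nonneg x.2]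
    simp only [Function.uncurry]
    rw [norm_mul, norm_mul, h2, mul_one]
    calc _ ≤ 1 * (b - a) := by gcongr
      _ = _ := one_mul _

theorem integral_integral_fejerKernel_eq_cdf (μ : Measure ℝ) [IsProbabilityMeasure μ]
    {a b : ℝ} (hab : a ≤ b) :
    ∫ y, (∫ z in a..b, fejerKernel (z - y)) ∂μ =
      ∫ w, fejerKernel w * (cdf μ (b - w) - cdf μ (a - w)) := by
  have step1 : ∀ y : ℝ, ∫ z in a..b, fejerKernel (z - y) =
      ∫ w, (Set.Ioc a b).indicator (fun _ => (1 : ℝ)) (w + y) * fejerKernel w := by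
    intro y
    rw [intervalIntegral.integral_of_le hab, ← integral_indicator measurableSet_Ioc,
      ← integral_add_right_eq_self _ y]
    refine integral_congr_ae (ae_of_all _ fun w => ?_)
    by_cases h : w + y ∈ Set.Ioc a b <;> simp [h]
  simp_rw [step1]
  rw [integral_integral_swap]
  · refine integral_congr_ae (ae_of_all _ fun w => ?_)
    simp only
    rw [integral_mul_const, mul_comm]
    congr 1
    have e : (fun y : ℝ => (Set.Ioc a b).indicator (fun _ => (1 : ℝ)) (w + y)) =
        (Set.Ioc (a - w) (b - w)).indicator fun _ => (1 : ℝ) := by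
      funext y
      simp only [Set.indicator, Set.mem_Ioc]
      congr 1
      rw [eq_iff_iff]
      constructor <;> rintro ⟨h1, h2⟩ <;> constructor <;> linarith
    rw [e, integral_indicator measurableSet_Ioc]
    simp only [integral_const, smul_eq_mul, mul_one, measureReal_restrict_apply_univ]
    rw [cdf_eq_real, cdf_eq_real, ← Set.Iic_sdiff_Iic,
      measureReal_sdiff (Set.Iic_subset_Iic.2 (by linarith)) measurableSet_Iic]
  · have hm : Measurable (Function.uncurry fun (y w : ℝ) =>
        (Set.Ioc a b).indicator (fun _ => (1 : ℝ)) (w + y) * fejerKernel w) := by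
      unfold Function.uncurry
      refine Measurable.mul ?_ (continuous_fejerKernel.measurable.comp measurable_snd)
      exact (measurable_const.indicator measurableSet_Ioc).comp
        (measurable_snd.add measurable_fst)
    refine (integrable_fejerKernel.comp_snd μ).mono' hm.aestronglyMeasurable
      (ae_of_all _ fun x => ?_)
    simp only [Function.uncurry]
    rw [norm_mul, Real.norm_of_nonneg (fejerKernel_nonneg _)]
    refine mul_le_of_le_one_left (fejerKernel_nonneg _) ?_
    by_cases h : x.2 + x.1 ∈ Set.Ioc a b <;> simp [h]

theorem abs_integral_fejerKernel_mul_cdf_sub_le (μ ν : Measure ℝ) [IsProbabilityMeasure μ]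
    [IsProbabilityMeasure ν] (h : ℝ → ℝ) (hh : Continuous h)
    (h0 : ∀ t, 0 ≤ h t)
    (hle : ∀ t : ℝ, |t| ≤ 1 → ‖charFun μ t - charFun ν t‖ ≤ |t| * h t) (b : ℝ) :
    |∫ w, fejerKernel w * (cdf μ (b - w) - cdf ν (b - w))| ≤ 2 * ∫ t in (-1 : ℝ)..1, h t := by
  have h11 : (-1 : ℝ) ≤ 1 := by norm_num
  have hmeas : ∀ (ρ : Measure ℝ) [IsProbabilityMeasure ρ] (x : ℝ),
      Measurable fun w => cdf ρ (x - w) := fun ρ _ x =>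
    (monotone_cdf ρ).measurable.comp (measurable_const.sub measurable_id)
  have hint : ∀ (ρ : Measure ℝ) [IsProbabilityMeasure ρ] (x : ℝ),
      Integrable fun w => fejerKernel w * cdf ρ (x - w) := fun ρ _ x => by
    refine integrable_fejerKernel.mono'
      (continuous_fejerKernel.measurable.mul (hmeas ρ x)).aestronglyMeasurable
      (ae_of_all _ fun w => ?_)
    rw [norm_mul, Real.norm_of_nonneg (fejerKernel_nonneg _), Real.norm_of_nonneg (cdf_nonneg _ _)]
    exact mul_le_of_le_one_right (fejerKernel_nonneg _) (cdf_le_one _ _)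
  have key : ∀ a ≤ b, |∫ w, fejerKernel w * (cdf μ (b - w) - cdf ν (b - w)) -
      fejerKernel w * (cdf μ (a - w) - cdf ν (a - w))| ≤ 2 * ∫ t in (-1 : ℝ)..1, h t := by
    intro a hab
    have e : (∫ w, fejerKernel w * (cdf μ (b - w) - cdf ν (b - w)) -
        fejerKernel w * (cdf μ (a - w) - cdf ν (a - w))) =
        (∫ y, (∫ z in a..b, fejerKernel (z - y)) ∂μ) -
          ∫ y, (∫ z in a..b, fejerKernel (z - y)) ∂ν := by
      rw [integral_integral_fejerKernel_eq_cdf μ hab, integral_integral_fejerKernel_eq_cdf ν hab,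
        ← integral_sub]
      · refine integral_congr_ae (ae_of_all _ fun w => ?_)
        simp only
        ring
      · simp_rw [mul_sub]
        exact (hint μ b).sub (hint μ a)
      · simp_rw [mul_sub]
        exact (hint ν b).sub (hint ν a)
    rw [e, ← Real.norm_eq_abs, ← Complex.norm_real, Complex.ofReal_sub,
      integral_integral_fejerKernel_eq_charFun μ hab,
      integral_integral_fejerKernel_eq_charFun ν hab]
    have hQ : Continuous fun t : ℝ => ∫ z in a..b, Complex.exp (t * z * Complex.I) := by
      refine intervalIntegral.continuous_parametric_intervalIntegral_of_continuous' ?_ a b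
      unfold Function.uncurry
      fun_prop
    have hc : ∀ (ρ : Measure ℝ) [IsProbabilityMeasure ρ], IntervalIntegrable (fun t : ℝ =>
        ((1 - |t| : ℝ) : ℂ) * (∫ z in a..b, Complex.exp (t * z * Complex.I)) * charFun ρ (-t))
        volume (-1) 1 := fun ρ _ => by
      have h1 : IntervalIntegrable (fun t => charFun ρ (-t)) volume (-1) 1 := by
        have := (intervalIntegrable_charFun (μ := ρ) (a := 1) (b := -1)).comp_sub_left 0
        simpa using this
      refine h1.continuousOn_mul (Continuous.continuousOn ?_)
      fun_prop
    rw [← intervalIntegral.integral_sub (hc μ) (hc ν)]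
    have e2 : ∫ t in (-1 : ℝ)..1, h t = ∫ t in (-1 : ℝ)..1, h (-t) := by
      rw [intervalIntegral.integral_comp_neg, neg_neg]
    rw [e2, ← intervalIntegral.integral_const_mul]
    refine intervalIntegral.norm_integral_le_of_norm_le h11 (ae_of_all _ fun t ht => ?_)
      (Continuous.intervalIntegrable (by fun_prop) _ _)
    have ht1 : |t| ≤ 1 := abs_le.2 ⟨ht.1.le, ht.2⟩
    have h2 := hle (-t) (by rwa [abs_neg])
    rw [abs_neg] at h2
    have h3 : ‖((1 - |t| : ℝ) : ℂ)‖ ≤ 1 := by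
      rw [Complex.norm_real, Real.norm_eq_abs, abs_le]
      constructor <;> linarith [abs_nonneg t]
    rw [← mul_sub, norm_mul, norm_mul]
    rcases eq_or_ne t 0 with rfl | hne
    · have h6 : ‖charFun μ (-0) - charFun ν (-0)‖ = 0 := by simp
      have h7 := h0 (-0)
      rw [h6, mul_zero]
      positivity
    · have h4 := norm_integral_exp_mul_I_le t a b hne
      calc _ ≤ 1 * (2 / |t|) * (|t| * h (-t)) := by gcongr
        _ = _ := by field_simp
  have hlim : Tendsto (fun a => ∫ w, fejerKernel w * (cdf μ (b - w) - cdf ν (b - w)) -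
      fejerKernel w * (cdf μ (a - w) - cdf ν (a - w))) atBot
      (𝓝 (∫ w, fejerKernel w * (cdf μ (b - w) - cdf ν (b - w)) -
        fejerKernel w * ((0 : ℝ) - 0))) := by
    refine tendsto_integral_filter_of_dominated_convergence
      (fun w => 2 * fejerKernel w) (Eventually.of_forall fun a => ?_)
      (Eventually.of_forall fun a => ae_of_all _ fun w => ?_)
      (integrable_fejerKernel.const_mul 2) (ae_of_all _ fun w => ?_)
    · have := hmeas μ
      have := hmeas ν
      have := continuous_fejerKernel.measurable
      exact Measurable.aestronglyMeasurable (by fun_prop)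
    · rw [← mul_sub, norm_mul, Real.norm_of_nonneg (fejerKernel_nonneg _), mul_comm]
      refine mul_le_mul_of_nonneg_right ?_ (fejerKernel_nonneg _)
      rw [Real.norm_eq_abs, abs_le]
      have h1 := cdf_nonneg μ (b - w)
      have h2 := cdf_nonneg μ (a - w)
      have h3 := cdf_nonneg ν (b - w)
      have h4 := cdf_nonneg ν (a - w)
      have h5 := cdf_le_one μ (b - w)
      have h6 := cdf_le_one μ (a - w)
      have h7 := cdf_le_one ν (b - w)
      have h8 := cdf_le_one ν (a - w)
      constructor <;> linarith
    · have hs : Tendsto (fun a : ℝ => a - w) atBot atBot :=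
        tendsto_atBot_add_const_right _ _ tendsto_id
      exact ((((tendsto_cdf_atBot μ).comp hs).sub ((tendsto_cdf_atBot ν).comp hs)).const_mul
        _).const_sub _
  simp only [sub_zero, mul_zero] at hlim
  exact le_of_tendsto hlim.abs ((eventually_le_atBot b).mono key)

theorem exists_cdf_sub_le_of_charFun_unit : ∃ C : ℝ, 0 < C ∧
    ∀ (μ ν : Measure ℝ) [IsProbabilityMeasure μ] [IsProbabilityMeasure ν] (m : ℝ)
      (_ : ∀ x y, x ≤ y → cdf ν y - cdf ν x ≤ m * (y - x))
      (h : ℝ → ℝ) (_ : Continuous h) (_ : ∀ t, 0 ≤ h t)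
      (_ : ∀ t : ℝ, |t| ≤ 1 → ‖charFun μ t - charFun ν t‖ ≤ |t| * h t) (x : ℝ),
      |cdf μ x - cdf ν x| ≤ C * ((∫ t in (-1 : ℝ)..1, h t) + m) := by
  set c := ∫ u, fejerKernel u with hc_def
  have hc : 0 < c := integral_fejerKernel_pos
  obtain ⟨r, hr, hrA⟩ : ∃ r : ℝ, 0 < r ∧ 3 / 4 * c ≤ ∫ u in (-r)..r, fejerKernel u := by
    have ht : Tendsto (fun r : ℝ => ∫ u in (-r)..r, fejerKernel u) atTop (𝓝 c) :=
      intervalIntegral_tendsto_integral integrable_fejerKernel tendsto_neg_atTop_atBot tendsto_id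
    have := (ht.eventually (lt_mem_nhds (show 3 / 4 * c < c by linarith))).and
      (eventually_gt_atTop (0 : ℝ))
    obtain ⟨r, h1, h2⟩ := this.exists
    exact ⟨r, h2, h1.le⟩
  set A := ∫ u in (-r)..r, fejerKernel u with hA
  have hAI : A = ∫ w, (Set.Ioc (-r) r).indicator fejerKernel w := by
    rw [hA, intervalIntegral.integral_of_le (by linarith), integral_indicator measurableSet_Ioc]
  have hIint : Integrable ((Set.Ioc (-r) r).indicator fejerKernel) :=
    integrable_fejerKernel.indicator measurableSet_Ioc
  have hAc : A ≤ c := by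
    rw [hAI, hc_def]
    refine integral_mono hIint integrable_fejerKernel fun w => ?_
    exact Set.indicator_le_self' (fun _ _ => fejerKernel_nonneg _) w
  refine ⟨4 / c + 3 * r, by positivity, fun μ ν _ _ m hm h hh h0 hle x => ?_⟩
  set Δ : ℝ → ℝ := fun x => cdf μ x - cdf ν x with hΔ
  have hΔ1 : ∀ x, |Δ x| ≤ 1 := fun x => by
    rw [abs_le]
    have h1 := cdf_nonneg μ x
    have h3 := cdf_nonneg ν x
    have h5 := cdf_le_one μ x
    have h7 := cdf_le_one ν x
    constructor <;> simp only [hΔ] <;> linarith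
  set D := ⨆ x, |Δ x| with hD
  have hbdd : BddAbove (Set.range fun x => |Δ x|) := ⟨1, by rintro _ ⟨x, rfl⟩; exact hΔ1 x⟩
  have hΔD : ∀ x, |Δ x| ≤ D := fun x => le_ciSup hbdd x
  have hD0 : 0 ≤ D := (abs_nonneg _).trans (hΔD 0)
  set J := ∫ t in (-1 : ℝ)..1, h t with hJ
  have hJ0 : 0 ≤ J := intervalIntegral.integral_nonneg (by norm_num) fun t _ => h0 t
  have hm0 : 0 ≤ m := by
    have := hm 0 1 zero_le_one
    have h2 := monotone_cdf ν (zero_le_one (α := ℝ))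
    linarith
  have hS := abs_integral_fejerKernel_mul_cdf_sub_le μ ν h hh h0 hle
  have hmeas : Measurable Δ := (monotone_cdf μ).measurable.sub (monotone_cdf ν).measurable
  have hint : ∀ b, Integrable fun w => fejerKernel w * Δ (b - w) := fun b => by
    refine integrable_fejerKernel.mono' (continuous_fejerKernel.measurable.mul
      (hmeas.comp (measurable_const.sub measurable_id))).aestronglyMeasurable
      (ae_of_all _ fun w => ?_)
    rw [norm_mul, Real.norm_of_nonneg (fejerKernel_nonneg _)]
    exact mul_le_of_le_one_right (fejerKernel_nonneg _) (hΔ1 _)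
  have lower : ∀ (b η σ : ℝ), (σ = 1 ∨ σ = -1) → (∀ w ∈ Set.Ioc (-r) r, η ≤ σ * Δ (b - w)) →
      (η + D) * A - D * c ≤ 2 * J := by
    intro b η σ hσ hw
    have h1 : (η + D) * A - D * c ≤ ∫ w, σ * (fejerKernel w * Δ (b - w)) := by
      have e : (η + D) * A - D * c =
          ∫ w, ((η + D) * (Set.Ioc (-r) r).indicator fejerKernel w - D * fejerKernel w) := by
        rw [integral_sub (hIint.const_mul _) (integrable_fejerKernel.const_mul _),
          integral_const_mul, integral_const_mul, ← hAI]
      rw [e]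
      refine integral_mono ((hIint.const_mul _).sub (integrable_fejerKernel.const_mul _))
        ((hint b).const_mul σ) fun w => ?_
      have hV := fejerKernel_nonneg w
      by_cases hmem : w ∈ Set.Ioc (-r) r
      · simp only [Set.indicator_of_mem hmem]
        have := mul_le_mul_of_nonneg_left (hw w hmem) hV
        linarith
      · simp only [Set.indicator_of_notMem hmem]
        have h2 := abs_le.1 (hΔD (b - w))
        have h3 : -D ≤ σ * Δ (b - w) := by
          rcases hσ with rfl | rfl <;> linarith
        have := mul_le_mul_of_nonneg_left h3 hV
        linarith
    rw [integral_const_mul] at h1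
    refine h1.trans ((le_abs_self _).trans ?_)
    rw [abs_mul, show |σ| = 1 by rcases hσ with rfl | rfl <;> simp, one_mul]
    exact hS b
  have finish : ∀ η : ℝ, (η + D) * A - D * c ≤ 2 * J → η ≤ 8 / (3 * c) * J + D / 3 := by
    intro η hη
    by_cases hneg : η ≤ 0
    · have : 0 ≤ 8 / (3 * c) * J := by positivity
      linarith
    · push Not at hneg
      have h1 : (η + D) * (3 / 4 * c) ≤ (η + D) * A := by gcongr
      have h2 : η * (3 / 4 * c) ≤ 2 * J + D * c / 4 := by linarith
      have h3 : η = η * (3 / 4 * c) * (4 / (3 * c)) := by field_simp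
      rw [h3]
      calc _ ≤ (2 * J + D * c / 4) * (4 / (3 * c)) := by gcongr
        _ = _ := by field_simp; ring
  have main : ∀ x, |Δ x| ≤ 2 * m * r + (8 / (3 * c) * J + D / 3) := by
    intro x
    rw [abs_le']
    constructor
    · have := finish (Δ x - 2 * m * r) (lower (x + r) _ 1 (Or.inl rfl) fun w hw => by
        have h1 : x ≤ x + r - w := by linarith [hw.2]
        have h2 := hm x _ h1
        have h3 := monotone_cdf μ h1
        have h4 : m * (x + r - w - x) ≤ m * (2 * r) := by
          gcongr; linarith [hw.1]
        simp only [hΔ]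
        linarith)
      linarith
    · have := finish (-Δ x - 2 * m * r) (lower (x - r) _ (-1) (Or.inr rfl) fun w hw => by
        have h1 : x - r - w ≤ x := by linarith [hw.1]
        have h2 := hm _ x h1
        have h3 := monotone_cdf μ h1
        have h4 : m * (x - (x - r - w)) ≤ m * (2 * r) := by
          gcongr; linarith [hw.2]
        simp only [hΔ]
        linarith)
      linarith
  have hDle : D ≤ 2 * m * r + (8 / (3 * c) * J + D / 3) := ciSup_le main
  have hfin : D ≤ 4 / c * J + 3 * r * m := by
    have : 8 / (3 * c) * J = 2 / 3 * (4 / c * J) := by field_simp; ring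
    linarith
  refine (hΔD x).trans (hfin.trans ?_)
  have h1 : 0 ≤ 4 / c * m := by positivity
  have h2 : 0 ≤ 3 * r * J := by positivity
  linarith

theorem cdf_gaussianReal_sub_le {x y : ℝ} (hxy : x ≤ y) :
    cdf (gaussianReal 0 1) y - cdf (gaussianReal 0 1) x ≤ y - x := by
  rw [cdf_eq_real, cdf_eq_real, ← measureReal_sdiff (Set.Iic_subset_Iic.2 hxy) measurableSet_Iic,
    Set.Iic_sdiff_Iic, measureReal_def, gaussianReal_apply_eq_integral _ one_ne_zero,
    ENNReal.toReal_ofReal (integral_nonneg fun _ => gaussianPDFReal_nonneg _ _ _),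
    ← intervalIntegral.integral_of_le hxy]
  have h1 : ∀ z, gaussianPDFReal 0 1 z ≤ 1 := fun z => by
    rw [gaussianPDFReal]
    have h2 : (√(2 * Real.pi * (1 : NNReal)))⁻¹ ≤ 1 := by
      refine inv_le_one_of_one_le₀ (Real.one_le_sqrt.2 ?_)
      simp only [NNReal.coe_one, mul_one]
      linarith [Real.pi_gt_three]
    have h3 : Real.exp (-(z - 0) ^ 2 / (2 * (1 : NNReal))) ≤ 1 := by
      rw [Real.exp_le_one_iff]
      simp only [NNReal.coe_one, mul_one]
      nlinarith [sq_nonneg (z - 0)]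
    exact mul_le_one₀ h2 (Real.exp_pos _).le h3
  calc _ ≤ ∫ z in x..y, (1 : ℝ) := by
        refine intervalIntegral.integral_mono hxy ?_ (by simp) h1
        exact (integrable_gaussianPDFReal 0 1).intervalIntegrable
    _ = y - x := by simp

theorem cdf_map_mul_left (μ : Measure ℝ) [IsProbabilityMeasure μ] {T : ℝ} (hT : 0 < T) (x : ℝ) :
    cdf (μ.map (T * ·)) x = cdf μ (x / T) := by
  have hm : Measurable fun y : ℝ => T * y := measurable_const_mul T
  have := Measure.isProbabilityMeasure_map (μ := μ) hm.aemeasurable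
  rw [cdf_eq_real, cdf_eq_real, map_measureReal_apply hm measurableSet_Iic]
  congr 1
  ext y
  simp [le_div_iff₀ hT, mul_comm]

/-- **Esseen's smoothing inequality** for the comparison with the standard normal distribution. -/
theorem exists_cdf_sub_gaussianReal_le_of_charFun : ∃ C : ℝ, 0 < C ∧
    ∀ (μ : Measure ℝ) [IsProbabilityMeasure μ] (T : ℝ) (_ : 0 < T)
      (h : ℝ → ℝ) (_ : Continuous h) (_ : ∀ t, 0 ≤ h t)
      (_ : ∀ t : ℝ, |t| ≤ T → ‖charFun μ t - charFun (gaussianReal 0 1) t‖ ≤ |t| * h t) (x : ℝ),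
      |cdf μ x - cdf (gaussianReal 0 1) x| ≤ C * ((∫ t in (-T)..T, h t) + 1 / T) := by
  obtain ⟨C, hC, H⟩ := exists_cdf_sub_le_of_charFun_unit
  refine ⟨C, hC, fun μ _ T hT h hh h0 hle x => ?_⟩
  have hm : Measurable fun y : ℝ => T * y := measurable_const_mul T
  have := Measure.isProbabilityMeasure_map (μ := μ) hm.aemeasurable
  have := Measure.isProbabilityMeasure_map (μ := gaussianReal 0 1) hm.aemeasurable
  have key := H (μ.map (T * ·)) ((gaussianReal 0 1).map (T * ·)) (1 / T) (fun x y hxy => by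
      rw [cdf_map_mul_left _ hT, cdf_map_mul_left _ hT]
      refine (cdf_gaussianReal_sub_le (by gcongr)).trans (le_of_eq ?_)
      ring) (fun t => T * h (T * t)) (by fun_prop) (fun t => mul_nonneg hT.le (h0 _))
    (fun t ht => by
      rw [charFun_map_mul, charFun_map_mul]
      refine (hle (T * t) ?_).trans (le_of_eq ?_)
      · rw [abs_mul, abs_of_pos hT]
        nlinarith
      · rw [abs_mul, abs_of_pos hT]
        ring) (T * x)
  rw [cdf_map_mul_left _ hT, cdf_map_mul_left _ hT, mul_div_cancel_left₀ _ hT.ne',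
    intervalIntegral.integral_const_mul, intervalIntegral.mul_integral_comp_mul_left] at key
  simpa using key

theorem elephantA_pos {p : ℝ} (hp : 0 < p) {n : ℕ} (hn : 1 ≤ n) : 0 < elephantA p n := by
  have h1 : (1 : ℝ) ≤ n := by exact_mod_cast hn
  have := Real.Gamma_pos_of_pos (show (0 : ℝ) < n by linarith)
  have := Real.Gamma_pos_of_pos (show (0 : ℝ) < 2 * p by linarith)
  have := Real.Gamma_pos_of_pos (show (0 : ℝ) < n + 2 * p - 1 by linarith)
  unfold elephantA
  positivity

theorem elephantA_succ_mul {p : ℝ} (hp : 0 < p) {n : ℕ} (hn : 1 ≤ n) :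
    elephantA p (n + 1) * (1 + (2 * p - 1) / n) = elephantA p n := by
  have h1 : (1 : ℝ) ≤ n := by exact_mod_cast hn
  have h2 : (n : ℝ) ≠ 0 := by positivity
  have h3 : (n : ℝ) + 2 * p - 1 ≠ 0 := by linarith
  have h4 := (Real.Gamma_pos_of_pos (show (0 : ℝ) < n + 2 * p - 1 by linarith)).ne'
  unfold elephantA
  rw [show ((n + 1 : ℕ) : ℝ) + 2 * p - 1 = (n + 2 * p - 1) + 1 by push_cast; ring,
    Real.Gamma_add_one h3, Nat.cast_add_one, Real.Gamma_add_one h2]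
  field_simp
  ring

theorem elephantV_succ (p : ℝ) (n : ℕ) :
    elephantV p (n + 1) = elephantV p n + elephantA p (n + 1) ^ 2 := by
  unfold elephantV
  rw [Finset.sum_Icc_succ_top (by omega)]

theorem elephantV_one {p : ℝ} (hp : 0 < p) : elephantV p 1 = 1 := by
  simp [elephantV, elephantA_one p hp]

theorem elephantV_mono (p : ℝ) : Monotone (elephantV p) :=
  monotone_nat_of_le_succ fun n => by
    rw [elephantV_succ]
    linarith [sq_nonneg (elephantA p (n + 1))]

theorem one_le_elephantV {p : ℝ} (hp : 0 < p) {n : ℕ} (hn : 1 ≤ n) : 1 ≤ elephantV p n :=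
  (elephantV_one hp).symm.le.trans (elephantV_mono p hn)

section
variable {Ω : Type*} [MeasurableSpace Ω] {μ : Measure Ω} [IsProbabilityMeasure μ]

theorem ae_eq_one_or_eq_neg_one {Y : Ω → ℝ} (hY : Measurable Y) {q : ℝ}
    (h1 : μ.real {ω | Y ω = 1} = q) (h2 : μ.real {ω | Y ω = -1} = 1 - q) :
    ∀ᵐ ω ∂μ, Y ω = 1 ∨ Y ω = -1 := by
  have m1 : MeasurableSet {ω | Y ω = 1} := hY (measurableSet_singleton 1)
  have m2 : MeasurableSet {ω | Y ω = -1} := hY (measurableSet_singleton (-1))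
  have hd : Disjoint {ω | Y ω = 1} {ω | Y ω = -1} := by
    rw [Set.disjoint_left]
    intro ω h h'
    simp only [Set.mem_ofPred_eq] at h h'
    norm_num [h] at h'
  have h : μ.real ({ω | Y ω = 1} ∪ {ω | Y ω = -1}) = 1 := by
    rw [measureReal_union hd m2, h1, h2]
    ring
  rw [measureReal_def, ENNReal.toReal_eq_one_iff] at h
  exact (mem_ae_iff_prob_eq_one (m1.union m2)).2 h

theorem integral_of_eq_one_or_eq_neg_one {Y : Ω → ℝ} (hY : Measurable Y) {q : ℝ}
    (h1 : μ.real {ω | Y ω = 1} = q) (h2 : μ.real {ω | Y ω = -1} = 1 - q) :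
    ∫ ω, Y ω ∂μ = 2 * q - 1 := by
  have m1 : MeasurableSet {ω | Y ω = 1} := hY (measurableSet_singleton 1)
  have m2 : MeasurableSet {ω | Y ω = -1} := hY (measurableSet_singleton (-1))
  have e : ∫ ω, Y ω ∂μ = ∫ ω, ({ω | Y ω = 1}.indicator (fun _ => (1 : ℝ)) ω -
      {ω | Y ω = -1}.indicator (fun _ => (1 : ℝ)) ω) ∂μ := by
    refine integral_congr_ae ?_
    filter_upwards [ae_eq_one_or_eq_neg_one hY h1 h2] with ω hω
    rcases hω with h | h <;> simp only [Set.indicator, Set.mem_ofPred_eq, h] <;> norm_num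
  rw [e, integral_sub ((integrable_const 1).indicator m1) ((integrable_const 1).indicator m2),
    integral_indicator_const _ m1, integral_indicator_const _ m2, h1, h2]
  simp only [smul_eq_mul]
  ring

variable {p q : ℝ} {X α : ℕ → Ω → ℝ} {β : ℕ → Ω → ℕ}

namespace IsElephantWalk

theorem ae_memory (hw : IsElephantWalk μ p q X α β) {n : ℕ} (hn : 1 ≤ n) :
    ∀ᵐ ω ∂μ, β (n + 1) ω ∈ Finset.Icc 1 n := by
  have hm : ∀ k, MeasurableSet {ω | β (n + 1) ω = k} := fun k =>
    hw.measurable_memory (n + 1) (measurableSet_singleton k)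
  have h : μ.real (⋃ k ∈ Finset.Icc 1 n, {ω | β (n + 1) ω = k}) = 1 := by
    rw [measureReal_biUnion_finset (fun i _ j _ hij => ?_) (fun k _ => hm k),
      Finset.sum_congr rfl (hw.memory_uniform n hn)]
    · have : (n : ℝ) ≠ 0 := by positivity
      simp [this]
    · rw [Function.onFun, Set.disjoint_left]
      intro ω h h'
      simp only [Set.mem_ofPred_eq] at h h'
      exact hij (h.symm.trans h')
  rw [measureReal_def, ENNReal.toReal_eq_one_iff] at h
  have := (mem_ae_iff_prob_eq_one (Finset.measurableSet_biUnion _ fun k _ => hm k)).2 h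
  filter_upwards [this] with ω hω
  simpa using hω

theorem ae_step (hw : IsElephantWalk μ p q X α β) {n : ℕ} (hn : 1 ≤ n) :
    ∀ᵐ ω ∂μ, X n ω = 1 ∨ X n ω = -1 := by
  induction n using Nat.strong_induction_on with
  | _ n ih =>
    rcases Nat.lt_or_ge 1 n with h1 | h1
    · obtain ⟨m, rfl⟩ : ∃ m, n = m + 1 := ⟨n - 1, by omega⟩
      have hm : 1 ≤ m := by omega
      have hall : ∀ᵐ ω ∂μ, ∀ k ∈ Finset.Icc 1 m, X k ω = 1 ∨ X k ω = -1 := by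
        rw [Finset.eventually_all]
        intro k hk
        rw [Finset.mem_Icc] at hk
        exact ih k (by omega) hk.1
      filter_upwards [hall, hw.step_succ m hm, hw.ae_memory hm,
        ae_eq_one_or_eq_neg_one (hw.measurable_sign _) (hw.sign_pos m hm) (hw.sign_neg m hm)]
        with ω h2 h3 h4 h5
      rw [h3]
      rcases h5 with h5 | h5 <;> rcases h2 _ h4 with h6 | h6 <;> simp [h5, h6]
    · obtain rfl : n = 1 := by omega
      exact ae_eq_one_or_eq_neg_one (hw.measurable_step 1) hw.first_step_pos hw.first_step_neg

theorem integral_sign_mul_indicator (hw : IsElephantWalk μ p q X α β) {n : ℕ} (hn : 1 ≤ n)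
    {k : ℕ} (hk : k ∈ Finset.Icc 1 n) :
    ∫ ω, α (n + 1) ω * ({k} : Set ℕ).indicator (fun _ => (1 : ℝ)) (β (n + 1) ω) ∂μ =
      (2 * p - 1) / n := by
  have hmi : Measurable (({k} : Set ℕ).indicator fun _ => (1 : ℝ)) := measurable_from_nat
  have hi : IndepFun (α (n + 1))
      (fun ω => ({k} : Set ℕ).indicator (fun _ => (1 : ℝ)) (β (n + 1) ω)) μ :=
    (hw.indep_sign_memory n hn).comp measurable_id hmi
  rw [hi.integral_fun_mul_eq_mul_integral (hw.measurable_sign _).aestronglyMeasurable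
    (hmi.comp (hw.measurable_memory _)).aestronglyMeasurable,
    integral_of_eq_one_or_eq_neg_one (hw.measurable_sign _) (hw.sign_pos n hn) (hw.sign_neg n hn)]
  have e : (fun ω => ({k} : Set ℕ).indicator (fun _ => (1 : ℝ)) (β (n + 1) ω)) =
      {ω | β (n + 1) ω = k}.indicator fun _ => (1 : ℝ) := by
    funext ω
    simp [Set.indicator]
  have hmk : MeasurableSet {ω | β (n + 1) ω = k} :=
    hw.measurable_memory (n + 1) (measurableSet_singleton k)
  have h1 : ∫ ω, {ω | β (n + 1) ω = k}.indicator (fun _ => (1 : ℝ)) ω ∂μ = _ :=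
    integral_indicator_const _ hmk
  rw [e, h1, hw.memory_uniform n hn k hk]
  simp only [smul_eq_mul]
  ring

theorem ae_abs_position_le (hw : IsElephantWalk μ p q X α β) (n : ℕ) :
    ∀ᵐ ω ∂μ, |elephantPosition X n ω| ≤ n := by
  have hall : ∀ᵐ ω ∂μ, ∀ k ∈ Finset.Icc 1 n, X k ω = 1 ∨ X k ω = -1 := by
    rw [Finset.eventually_all]
    intro k hk
    rw [Finset.mem_Icc] at hk
    exact hw.ae_step hk.1
  filter_upwards [hall] with ω h
  unfold elephantPosition
  refine (Finset.abs_sum_le_sum_abs _ _).trans ?_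
  refine (Finset.sum_le_card_nsmul _ _ 1 fun k hk => ?_).trans (by simp)
  rcases h k hk with h | h <;> simp [h]

theorem measurable_position (hw : IsElephantWalk μ p q X α β) (n : ℕ) :
    Measurable (elephantPosition X n) :=
  Finset.measurable_fun_sum _ fun k _ => hw.measurable_step k

/-- The conditional mean of the next step, tested against a bounded function of the past. -/
theorem integral_mul_step_succ (hw : IsElephantWalk μ p q X α β) {n : ℕ} (hn : 1 ≤ n)
    {g : (Finset.Icc 1 n → ℝ) → ℂ} (hg : Measurable g) {B : ℝ}
    (hB : ∀ᵐ ω ∂μ, ‖g (fun i => X i ω)‖ ≤ B) :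
    ∫ ω, g (fun i => X i ω) * (X (n + 1) ω : ℂ) ∂μ =
      ∫ ω, g (fun i => X i ω) * (((2 * p - 1) / n * elephantPosition X n ω : ℝ) : ℂ) ∂μ := by
  set ι : ℕ → ℕ → ℝ := fun k => ({k} : Set ℕ).indicator fun _ => (1 : ℝ) with hι
  have hιm : ∀ k, Measurable (ι k) := fun k => measurable_from_nat
  have hpast : Measurable fun ω (i : Finset.Icc 1 n) => X i ω :=
    measurable_pi_lambda _ fun i => hw.measurable_step i
  have hG : Measurable fun ω => g (fun i => X i ω) := hg.comp hpast
  have hGX : ∀ k, Measurable fun ω => g (fun i => X i ω) * (X k ω : ℂ) := fun k =>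
    hG.mul (Complex.measurable_ofReal.comp (hw.measurable_step k))
  have hGXb : ∀ k ∈ Finset.Icc 1 n, ∀ᵐ ω ∂μ, ‖g (fun i => X i ω) * (X k ω : ℂ)‖ ≤ B := by
    intro k hk
    filter_upwards [hB, hw.ae_step (Finset.mem_Icc.1 hk).1] with ω h1 h2
    rcases h2 with h2 | h2 <;> simpa [h2] using h1
  have hGXi : ∀ k ∈ Finset.Icc 1 n, Integrable (fun ω => g (fun i => X i ω) * (X k ω : ℂ)) μ :=
    fun k hk => Integrable.of_bound (hGX k).aestronglyMeasurable B (hGXb k hk)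
  have hαm : ∀ k, Measurable fun ω => α (n + 1) ω * ι k (β (n + 1) ω) := fun k =>
    (hw.measurable_sign _).mul ((hιm k).comp (hw.measurable_memory _))
  have hαb : ∀ k, ∀ᵐ ω ∂μ, ‖α (n + 1) ω * ι k (β (n + 1) ω)‖ ≤ 1 := fun k => by
    filter_upwards [ae_eq_one_or_eq_neg_one (hw.measurable_sign _) (hw.sign_pos n hn)
      (hw.sign_neg n hn)] with ω h
    have h2 : |ι k (β (n + 1) ω)| ≤ 1 := by
      by_cases hk : β (n + 1) ω = k <;> simp [hι, hk]
    rcases h with h | h <;> simpa [h] using h2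
  have hterm : ∀ k ∈ Finset.Icc 1 n,
      Integrable (fun ω => g (fun i => X i ω) * (X k ω : ℂ) *
        ((α (n + 1) ω * ι k (β (n + 1) ω) : ℝ) : ℂ)) μ ∧
      ∫ ω, g (fun i => X i ω) * (X k ω : ℂ) *
        ((α (n + 1) ω * ι k (β (n + 1) ω) : ℝ) : ℂ) ∂μ =
      (∫ ω, g (fun i => X i ω) * (X k ω : ℂ) ∂μ) * (((2 * p - 1) / n : ℝ) : ℂ) := by
    intro k hk
    have hm : Measurable fun ω => ((α (n + 1) ω * ι k (β (n + 1) ω) : ℝ) : ℂ) :=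
      Complex.measurable_ofReal.comp (hαm k)
    have hind : IndepFun (fun ω => g (fun i => X i ω) * (X k ω : ℂ))
        (fun ω => ((α (n + 1) ω * ι k (β (n + 1) ω) : ℝ) : ℂ)) μ := by
      have h1 : Measurable fun x : Finset.Icc 1 n → ℝ => g x * ((x ⟨k, hk⟩ : ℝ) : ℂ) :=
        hg.mul (Complex.measurable_ofReal.comp (measurable_pi_apply _))
      have h2 : Measurable fun y : ℝ × ℕ => ((y.1 * ι k y.2 : ℝ) : ℂ) :=
        Complex.measurable_ofReal.comp (measurable_fst.mul ((hιm k).comp measurable_snd))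
      exact (hw.indep_past n hn).symm.comp h1 h2
    refine ⟨Integrable.of_bound ((hGX k).mul hm).aestronglyMeasurable (B * 1) ?_, ?_⟩
    · filter_upwards [hGXb k hk, hαb k] with ω h1 h2
      rw [norm_mul, Complex.norm_real]
      have : 0 ≤ B := (norm_nonneg _).trans h1
      gcongr
    · rw [hind.integral_fun_mul_eq_mul_integral (hGX k).aestronglyMeasurable
        hm.aestronglyMeasurable, integral_complex_ofReal, hw.integral_sign_mul_indicator hn hk]
  calc ∫ ω, g (fun i => X i ω) * (X (n + 1) ω : ℂ) ∂μ
      = ∫ ω, ∑ k ∈ Finset.Icc 1 n, g (fun i => X i ω) * (X k ω : ℂ) *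
        ((α (n + 1) ω * ι k (β (n + 1) ω) : ℝ) : ℂ) ∂μ := by
        refine integral_congr_ae ?_
        filter_upwards [hw.step_succ n hn, hw.ae_memory hn] with ω h1 h2
        rw [Finset.sum_eq_single_of_mem _ h2 fun k _ hk => by
          simp [hι, hk.symm]]
        rw [h1]
        simp only [hι, Set.indicator, Set.mem_singleton_iff, if_true]
        push_cast
        ring
    _ = ∑ k ∈ Finset.Icc 1 n,
        (∫ ω, g (fun i => X i ω) * (X k ω : ℂ) ∂μ) * (((2 * p - 1) / n : ℝ) : ℂ) := by
        rw [integral_finsetSum _ fun k hk => (hterm k hk).1]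
        exact Finset.sum_congr rfl fun k hk => (hterm k hk).2
    _ = ∫ ω, ∑ k ∈ Finset.Icc 1 n, g (fun i => X i ω) * (X k ω : ℂ) *
          (((2 * p - 1) / n : ℝ) : ℂ) ∂μ := by
        rw [integral_finsetSum _ fun k hk => (hGXi k hk).mul_const _]
        exact Finset.sum_congr rfl fun k _ => (integral_mul_const _ _).symm
    _ = _ := by
        refine integral_congr_ae (ae_of_all _ fun ω => ?_)
        simp only [elephantPosition]
        push_cast
        rw [Finset.mul_sum, Finset.mul_sum]
        refine Finset.sum_congr rfl fun k _ => ?_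
        ring

end IsElephantWalk
end

theorem norm_exp_mul_I_sub_one_sub_le (x : ℝ) :
    ‖Complex.exp (x * Complex.I) - 1 - x * Complex.I‖ ≤ 3 * x ^ 2 := by
  have hn : ‖(x : ℂ) * Complex.I‖ = |x| := by simp
  rcases le_total |x| 1 with h | h
  · refine (Complex.norm_exp_sub_one_sub_id_le (by rwa [hn])).trans ?_
    rw [hn, sq_abs]
    linarith [sq_nonneg x]
  · calc _ ≤ ‖Complex.exp (x * Complex.I)‖ + ‖(1 : ℂ)‖ + ‖(x : ℂ) * Complex.I‖ :=
          (norm_sub_le _ _).trans (by gcongr; exact norm_sub_le _ _)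
      _ = 1 + 1 + |x| := by rw [Complex.norm_exp_ofReal_mul_I, hn, norm_one]
      _ ≤ 3 * x ^ 2 := by rw [← sq_abs]; nlinarith

theorem abs_sin_sub_mul_cos_le (x : ℝ) : |Real.sin x - x * Real.cos x| ≤ |x| ^ 3 := by
  have h1 := Real.abs_sub_sin_le x
  have h2 : |x * (1 - Real.cos x)| ≤ |x| ^ 3 / 2 := by
    rw [abs_mul, abs_of_nonneg (a := 1 - Real.cos x) (by linarith [Real.cos_le_one x])]
    have := Real.one_sub_sq_div_two_le_cos (x := x)
    have h3 : |x| * (1 - Real.cos x) ≤ |x| * (x ^ 2 / 2) := by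
      gcongr
      linarith
    rw [← sq_abs] at h3
    linarith [h3]
  rw [show Real.sin x - x * Real.cos x = x * (1 - Real.cos x) - (x - Real.sin x) by ring]
  refine (abs_sub _ _).trans ?_
  have := pow_nonneg (abs_nonneg x) 3
  linarith

/-- Comparison of the characteristic function at `τ` of a centred sign with mean `m` before
centring with that of a symmetric sign. -/
theorem norm_exp_mul_cos_add_sin_sub_cos_le (τ m : ℝ) (hm : |m| ≤ 1) :
    ‖Complex.exp ((-(τ * m) : ℝ) * Complex.I) *
        (Real.cos τ + m * Real.sin τ * Complex.I) - Real.cos τ‖ ≤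
      4 * τ ^ 2 * m ^ 2 + |τ| ^ 3 * |m| := by
  set R := Complex.exp ((-(τ * m) : ℝ) * Complex.I) - 1 - (-(τ * m) : ℝ) * Complex.I with hR
  have hRn : ‖R‖ ≤ 3 * (τ * m) ^ 2 := by
    have := norm_exp_mul_I_sub_one_sub_le (-(τ * m))
    rwa [neg_sq] at this
  have hE : Complex.exp ((-(τ * m) : ℝ) * Complex.I) = R + 1 + (-(τ * m) : ℝ) * Complex.I := by
    rw [hR]; ring
  have hw : ‖(Real.cos τ : ℂ) + m * Real.sin τ * Complex.I‖ ≤ 1 := by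
    rw [← Complex.ofReal_mul, Complex.norm_add_mul_I]
    rw [Real.sqrt_le_one]
    have h1 := Real.sin_sq_add_cos_sq τ
    have h2 : m ^ 2 ≤ 1 := by rw [← sq_abs]; exact pow_le_one₀ (abs_nonneg _) hm
    nlinarith [sq_nonneg (Real.sin τ)]
  have hs : |τ * m ^ 2 * Real.sin τ| ≤ τ ^ 2 * m ^ 2 := by
    have h1 : |Real.sin τ| ≤ |τ| := Real.abs_sin_le_abs
    rw [abs_mul, abs_mul, abs_of_nonneg (sq_nonneg m)]
    calc |τ| * m ^ 2 * |Real.sin τ| ≤ |τ| * m ^ 2 * |τ| := by gcongr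
      _ = τ ^ 2 * m ^ 2 := by rw [← sq_abs τ]; ring
  have e : Complex.exp ((-(τ * m) : ℝ) * Complex.I) *
        (Real.cos τ + m * Real.sin τ * Complex.I) - Real.cos τ =
      R * (Real.cos τ + m * Real.sin τ * Complex.I) +
        ((m * (Real.sin τ - τ * Real.cos τ) : ℝ) : ℂ) * Complex.I +
        ((τ * m ^ 2 * Real.sin τ : ℝ) : ℂ) := by
    rw [hE]
    push_cast
    linear_combination (-(τ : ℂ) * m ^ 2 * Complex.sin τ) * Complex.I_sq
  rw [e]
  refine (norm_add₃_le).trans ?_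
  rw [norm_mul, norm_mul, Complex.norm_I, Complex.norm_real, Complex.norm_real, mul_one,
    Real.norm_eq_abs, Real.norm_eq_abs, abs_mul m]
  have h1 : ‖R‖ * ‖(Real.cos τ : ℂ) + m * Real.sin τ * Complex.I‖ ≤ 3 * (τ * m) ^ 2 * 1 := by
    gcongr
  have h2 : |m| * |Real.sin τ - τ * Real.cos τ| ≤ |m| * |τ| ^ 3 := by
    gcongr
    exact abs_sin_sub_mul_cos_le τ
  linarith [mul_pow τ m 2]

/-- The bound `v_k / (a_k k)²` for the mean square of the conditional mean of step `k + 1`. -/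
noncomputable def elephantDrift (p : ℝ) (k : ℕ) : ℝ :=
  if k = 0 then 1 else elephantV p k / (elephantA p k * k) ^ 2

theorem elephantDrift_nonneg (p : ℝ) (k : ℕ) : 0 ≤ elephantDrift p k := by
  unfold elephantDrift
  split_ifs
  · exact zero_le_one
  · have : 0 ≤ elephantV p k := Finset.sum_nonneg fun i _ => sq_nonneg _
    positivity

/-- The characteristic function of `a_n T_n - (2 q - 1)`, set to `1` at time `0`. -/
noncomputable def elephantCharFun {Ω : Type*} [MeasurableSpace Ω] (μ : Measure Ω) (p q : ℝ)
    (X : ℕ → Ω → ℝ) (n : ℕ) (t : ℝ) : ℂ :=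
  if n = 0 then 1 else
    ∫ ω, Complex.exp ((t * (elephantA p n * elephantPosition X n ω - (2 * q - 1)) : ℝ) *
      Complex.I) ∂μ

theorem exp_mul_I_of_eq_one_or_eq_neg_one {x : ℝ} (hx : x = 1 ∨ x = -1) (τ : ℝ) :
    Complex.exp ((τ * x : ℝ) * Complex.I) = Real.cos τ + x * Real.sin τ * Complex.I := by
  rw [Complex.exp_mul_I, ← Complex.ofReal_cos, ← Complex.ofReal_sin]
  rcases hx with rfl | rfl <;> simp

theorem elephantPosition_eq_sum_coe {Ω : Type*} (X : ℕ → Ω → ℝ) (n : ℕ) (ω : Ω) :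
    elephantPosition X n ω = ∑ i : Finset.Icc 1 n, X i ω := by
  unfold elephantPosition
  rw [← Finset.sum_coe_sort]

theorem elephantPosition_succ {Ω : Type*} (X : ℕ → Ω → ℝ) (n : ℕ) (ω : Ω) :
    elephantPosition X (n + 1) ω = elephantPosition X n ω + X (n + 1) ω := by
  unfold elephantPosition
  rw [Finset.sum_Icc_succ_top (by omega)]

section
variable {Ω : Type*} [MeasurableSpace Ω] {μ : Measure Ω} [IsProbabilityMeasure μ]
variable {p q : ℝ} {X α : ℕ → Ω → ℝ} {β : ℕ → Ω → ℕ}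

namespace IsElephantWalk

theorem integrable_position_sq (hw : IsElephantWalk μ p q X α β) (n : ℕ) :
    Integrable (fun ω => elephantPosition X n ω ^ 2) μ := by
  refine Integrable.of_bound ((hw.measurable_position n).pow_const 2).aestronglyMeasurable
    ((n : ℝ) ^ 2) ?_
  filter_upwards [hw.ae_abs_position_le n] with ω h
  rw [norm_pow, Real.norm_eq_abs]
  gcongr

theorem integral_position_mul_step (hw : IsElephantWalk μ p q X α β) {n : ℕ} (hn : 1 ≤ n) :
    ∫ ω, elephantPosition X n ω * X (n + 1) ω ∂μ =
      (2 * p - 1) / n * ∫ ω, elephantPosition X n ω ^ 2 ∂μ := by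
  have h := hw.integral_mul_step_succ hn (g := fun x => ((∑ i, x i : ℝ) : ℂ))
    (Complex.measurable_ofReal.comp
      (Finset.measurable_fun_sum _ fun i _ => measurable_pi_apply i)) (B := n) (by
      filter_upwards [hw.ae_abs_position_le n] with ω h
      rwa [Complex.norm_real, Real.norm_eq_abs, ← elephantPosition_eq_sum_coe])
  simp_rw [← elephantPosition_eq_sum_coe, ← Complex.ofReal_mul, integral_complex_ofReal] at h
  rw [Complex.ofReal_inj.1 h, ← integral_const_mul]
  congr 1
  funext ω
  ring

theorem integral_position_sq_succ (hw : IsElephantWalk μ p q X α β) {n : ℕ} (hn : 1 ≤ n) :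
    ∫ ω, elephantPosition X (n + 1) ω ^ 2 ∂μ =
      (1 + 2 * ((2 * p - 1) / n)) * (∫ ω, elephantPosition X n ω ^ 2 ∂μ) + 1 := by
  have hi : Integrable (fun ω => elephantPosition X n ω * X (n + 1) ω) μ := by
    refine Integrable.of_bound
      ((hw.measurable_position n).mul (hw.measurable_step _)).aestronglyMeasurable n ?_
    filter_upwards [hw.ae_abs_position_le n, hw.ae_step (show 1 ≤ n + 1 by omega)] with ω h h2
    rcases h2 with h2 | h2 <;> simpa [h2] using h
  have e : ∫ ω, elephantPosition X (n + 1) ω ^ 2 ∂μ =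
      ∫ ω, ((elephantPosition X n ω ^ 2 + 2 * (elephantPosition X n ω * X (n + 1) ω)) + 1) ∂μ := by
    refine integral_congr_ae ?_
    filter_upwards [hw.ae_step (show 1 ≤ n + 1 by omega)] with ω h
    rw [elephantPosition_succ]
    rcases h with h | h <;> rw [h] <;> ring
  have hsum : Integrable (fun ω => elephantPosition X n ω ^ 2 +
      2 * (elephantPosition X n ω * X (n + 1) ω)) μ :=
    (hw.integrable_position_sq n).add (hi.const_mul 2)
  rw [e, integral_add hsum (integrable_const 1), integral_add (hw.integrable_position_sq n) (hi.const_mul 2),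
    integral_const_mul,
    hw.integral_position_mul_step hn]
  simp
  ring

theorem integral_position_sq_le (hw : IsElephantWalk μ p q X α β) (hp : 0 < p) {n : ℕ}
    (hn : 1 ≤ n) :
    elephantA p n ^ 2 * ∫ ω, elephantPosition X n ω ^ 2 ∂μ ≤ elephantV p n := by
  induction n, hn using Nat.le_induction with
  | base =>
    rw [elephantV_one hp, elephantA_one p hp, one_pow, one_mul]
    have e : ∫ ω, elephantPosition X 1 ω ^ 2 ∂μ = ∫ _, (1 : ℝ) ∂μ := by
      refine integral_congr_ae ?_
      filter_upwards [hw.ae_step le_rfl] with ω h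
      rcases h with h | h <;> simp [elephantPosition, h]
    rw [e]
    simp
  | succ n hn ih =>
    rw [hw.integral_position_sq_succ hn, elephantV_succ]
    have hI : 0 ≤ ∫ ω, elephantPosition X n ω ^ 2 ∂μ := integral_nonneg fun _ => sq_nonneg _
    have ha := elephantA_succ_mul hp hn
    have h1 : elephantA p (n + 1) ^ 2 * (1 + 2 * ((2 * p - 1) / n)) ≤ elephantA p n ^ 2 := by
      rw [← ha, mul_pow]
      gcongr
      nlinarith [sq_nonneg ((2 * p - 1) / (n : ℝ))]
    have h2 := mul_le_mul_of_nonneg_right h1 hI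
    linarith

theorem norm_charFun_succ_sub_le_of_one_le (hw : IsElephantWalk μ p q X α β) (hp : 0 < p)
    (hp1 : p ≤ 1) {n : ℕ} (hn : 1 ≤ n) (t : ℝ) :
    ‖elephantCharFun μ p q X (n + 1) t -
        Real.cos (t * elephantA p (n + 1)) * elephantCharFun μ p q X n t‖ ≤
      4 * (t * elephantA p (n + 1)) ^ 2 * elephantDrift p n +
        |t * elephantA p (n + 1)| ^ 3 * √(elephantDrift p n) := by
  set τ := t * elephantA p (n + 1) with hτ
  have hn0 : (0 : ℝ) < n := by exact_mod_cast hn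
  set m : Ω → ℝ := fun ω => (2 * p - 1) / n * elephantPosition X n ω with hm
  have hρ : |2 * p - 1| ≤ 1 := abs_le.2 ⟨by linarith, by linarith⟩
  have hmm : Measurable m := (hw.measurable_position n).const_mul _
  have hm1 : ∀ᵐ ω ∂μ, |m ω| ≤ 1 := by
    filter_upwards [hw.ae_abs_position_le n] with ω h
    rw [hm, abs_mul, abs_div, abs_of_pos hn0]
    calc |2 * p - 1| / n * |elephantPosition X n ω| ≤ 1 / n * n := by gcongr
      _ = 1 := by field_simp
  have hm2i : Integrable (fun ω => m ω ^ 2) μ := by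
    refine Integrable.of_bound (hmm.pow_const 2).aestronglyMeasurable 1 ?_
    filter_upwards [hm1] with ω h
    rw [norm_pow, Real.norm_eq_abs]
    exact pow_le_one₀ (abs_nonneg _) h
  have hmi : Integrable (fun ω => |m ω|) μ := by
    refine Integrable.of_bound hmm.abs.aestronglyMeasurable 1 ?_
    filter_upwards [hm1] with ω h
    simpa using h
  have hE2 : ∫ ω, m ω ^ 2 ∂μ ≤ elephantDrift p n := by
    simp only [hm, mul_pow]
    rw [integral_const_mul, elephantDrift, if_neg (by omega)]
    have h1 := hw.integral_position_sq_le hp hn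
    have ha := elephantA_pos hp hn
    have h2 : (2 * p - 1) ^ 2 ≤ 1 := by rw [← sq_abs]; exact pow_le_one₀ (abs_nonneg _) hρ
    have hI : 0 ≤ ∫ ω, elephantPosition X n ω ^ 2 ∂μ := integral_nonneg fun _ => sq_nonneg _
    rw [div_pow, mul_pow, le_div_iff₀ (by positivity)]
    calc _ = (2 * p - 1) ^ 2 *
          (elephantA p n ^ 2 * ∫ ω, elephantPosition X n ω ^ 2 ∂μ) := by field_simp
      _ ≤ 1 * elephantV p n := by gcongr
      _ = _ := one_mul _
  have hE1 : ∫ ω, |m ω| ∂μ ≤ √(elephantDrift p n) := by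
    refine Real.le_sqrt_of_sq_le (le_trans ?_ hE2)
    have hv : 0 ≤ ∫ ω, (|m ω| - ∫ ω', |m ω'| ∂μ) ^ 2 ∂μ := integral_nonneg fun _ => sq_nonneg _
    set c := ∫ ω', |m ω'| ∂μ with hc
    have e : ∫ ω, (|m ω| - c) ^ 2 ∂μ = ∫ ω, ((m ω ^ 2 - 2 * c * |m ω|) + c ^ 2) ∂μ := by
      congr 1
      funext ω
      rw [← sq_abs (m ω)]
      ring
    have hsub : Integrable (fun ω => m ω ^ 2 - 2 * c * |m ω|) μ := hm2i.sub (hmi.const_mul _)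
    rw [e, integral_add hsub (integrable_const _),
      integral_sub hm2i (hmi.const_mul _), integral_const_mul, ← hc] at hv
    simp at hv
    linarith
  set f : ℝ → ℂ := fun x => Complex.exp
    ((t * (elephantA p n * x - (2 * q - 1)) : ℝ) * Complex.I) with hf
  set g : ℝ → ℂ := fun x => Complex.exp ((-(τ * ((2 * p - 1) / n * x)) : ℝ) * Complex.I) with hg
  have hfm : Measurable f := by rw [hf]; fun_prop
  have hgm : Measurable g := by rw [hg]; fun_prop
  have hf1 : ∀ x, ‖f x‖ = 1 := fun x => Complex.norm_exp_ofReal_mul_I _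
  have hg1 : ∀ x, ‖g x‖ = 1 := fun x => Complex.norm_exp_ofReal_mul_I _
  have hT := hw.measurable_position n
  have hfT : Measurable fun ω => f (elephantPosition X n ω) := hfm.comp hT
  have hgT : Measurable fun ω => g (elephantPosition X n ω) := hgm.comp hT
  have hXm : Measurable fun ω => (X (n + 1) ω : ℂ) :=
    Complex.measurable_ofReal.comp (hw.measurable_step _)
  have hmc : Measurable fun ω => (m ω : ℂ) := Complex.measurable_ofReal.comp hmm
  have hfgi : Integrable (fun ω => f (elephantPosition X n ω) * g (elephantPosition X n ω)) μ := by
    refine Integrable.of_bound (hfT.mul hgT).aestronglyMeasurable 1 (ae_of_all _ fun ω => ?_)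
    rw [norm_mul, hf1, hg1, one_mul]
  have hfgX : Integrable (fun ω => f (elephantPosition X n ω) * g (elephantPosition X n ω) *
      (X (n + 1) ω : ℂ)) μ := by
    refine Integrable.of_bound ((hfT.mul hgT).mul hXm).aestronglyMeasurable 1 ?_
    filter_upwards [hw.ae_step (show 1 ≤ n + 1 by omega)] with ω h
    rw [norm_mul, norm_mul, hf1, hg1, one_mul, one_mul]
    rcases h with h | h <;> simp [h]
  have hfgm : Integrable (fun ω => f (elephantPosition X n ω) * g (elephantPosition X n ω) *
      (m ω : ℂ)) μ := by
    refine Integrable.of_bound ((hfT.mul hgT).mul hmc).aestronglyMeasurable 1 ?_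
    filter_upwards [hm1] with ω h
    rw [norm_mul, norm_mul, hf1, hg1, one_mul, one_mul]
    simpa using h
  have hswap : ∫ ω, f (elephantPosition X n ω) * g (elephantPosition X n ω) *
      (X (n + 1) ω : ℂ) ∂μ =
      ∫ ω, f (elephantPosition X n ω) * g (elephantPosition X n ω) * (m ω : ℂ) ∂μ := by
    have h := hw.integral_mul_step_succ hn
      (g := fun x => f (∑ i, x i) * g (∑ i, x i))
      ((hfm.mul hgm).comp (Finset.measurable_fun_sum _ fun i _ => measurable_pi_apply i))
      (B := 1) (ae_of_all _ fun ω => by rw [norm_mul, hf1, hg1, one_mul])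
    simpa only [← elephantPosition_eq_sum_coe] using h
  have hleft : elephantCharFun μ p q X (n + 1) t =
      ∫ ω, f (elephantPosition X n ω) *
        (g (elephantPosition X n ω) * (Real.cos τ + m ω * Real.sin τ * Complex.I)) ∂μ := by
    have e1 : elephantCharFun μ p q X (n + 1) t =
        ∫ ω, (f (elephantPosition X n ω) * g (elephantPosition X n ω) * Real.cos τ +
          f (elephantPosition X n ω) * g (elephantPosition X n ω) * X (n + 1) ω *
            (Real.sin τ * Complex.I)) ∂μ := by
      rw [elephantCharFun, if_neg (by omega)]
      refine integral_congr_ae ?_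
      filter_upwards [hw.ae_step (show 1 ≤ n + 1 by omega)] with ω h
      have e2 : t * (elephantA p (n + 1) * elephantPosition X (n + 1) ω - (2 * q - 1)) =
          t * (elephantA p n * elephantPosition X n ω - (2 * q - 1)) +
          -(τ * ((2 * p - 1) / n * elephantPosition X n ω)) + τ * X (n + 1) ω := by
        rw [elephantPosition_succ, ← elephantA_succ_mul hp hn, hτ]
        ring
      rw [e2, Complex.ofReal_add, Complex.ofReal_add, add_mul, add_mul, Complex.exp_add,
        Complex.exp_add, exp_mul_I_of_eq_one_or_eq_neg_one h]
      simp only [hf, hg]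
      ring
    rw [e1, integral_add (hfgi.mul_const _) (hfgX.mul_const _), integral_mul_const _,
      integral_mul_const, hswap, ← integral_mul_const, ← integral_mul_const,
      ← integral_add (hfgi.mul_const _) (hfgm.mul_const _)]
    congr 1
    funext ω
    ring
  have hright : elephantCharFun μ p q X n t = ∫ ω, f (elephantPosition X n ω) ∂μ := by
    rw [elephantCharFun, if_neg (by omega)]
  have hfi : Integrable (fun ω => f (elephantPosition X n ω)) μ := by
    refine Integrable.of_bound hfT.aestronglyMeasurable 1 (ae_of_all _ fun ω => ?_)
    rw [hf1]
  have hLi : Integrable (fun ω => f (elephantPosition X n ω) *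
        (g (elephantPosition X n ω) * (Real.cos τ + m ω * Real.sin τ * Complex.I))) μ := by
    have := (hfgi.mul_const (Real.cos τ : ℂ)).add (hfgm.mul_const (Real.sin τ * Complex.I))
    refine this.congr (ae_of_all _ fun ω => ?_)
    simp only [Pi.add_apply]
    ring
  rw [hleft, hright, ← integral_const_mul, ← integral_sub hLi (hfi.const_mul _)]
  calc _ ≤ ∫ ω, (4 * τ ^ 2 * m ω ^ 2 + |τ| ^ 3 * |m ω|) ∂μ := by
        refine norm_integral_le_of_norm_le ((hm2i.const_mul _).add (hmi.const_mul _)) ?_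
        filter_upwards [hm1] with ω h
        have := norm_exp_mul_cos_add_sin_sub_cos_le τ (m ω) h
        have e : f (elephantPosition X n ω) * (g (elephantPosition X n ω) *
            (Real.cos τ + m ω * Real.sin τ * Complex.I)) -
            Real.cos τ * f (elephantPosition X n ω) =
            f (elephantPosition X n ω) * (Complex.exp ((-(τ * m ω) : ℝ) * Complex.I) *
            (Real.cos τ + m ω * Real.sin τ * Complex.I) - Real.cos τ) := by
          simp only [hg, hm]
          ring
        rw [e, norm_mul, hf1, one_mul]
        exact this
    _ = 4 * τ ^ 2 * (∫ ω, m ω ^ 2 ∂μ) + |τ| ^ 3 * ∫ ω, |m ω| ∂μ := by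
        rw [integral_add (hm2i.const_mul _) (hmi.const_mul _), integral_const_mul,
          integral_const_mul]
    _ ≤ _ := by gcongr

theorem norm_charFun_one_sub_le (hw : IsElephantWalk μ p q X α β) (hp : 0 < p)
    (hq : 0 ≤ q) (hq1 : q ≤ 1) (t : ℝ) :
    ‖elephantCharFun μ p q X 1 t - Real.cos t‖ ≤ 4 * t ^ 2 + |t| ^ 3 := by
  have hc : |2 * q - 1| ≤ 1 := abs_le.2 ⟨by linarith, by linarith⟩
  have hXi : Integrable (fun ω => (X 1 ω : ℂ)) μ := by
    refine Integrable.of_bound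
      (Complex.measurable_ofReal.comp (hw.measurable_step 1)).aestronglyMeasurable 1 ?_
    filter_upwards [hw.ae_step le_rfl] with ω h
    rcases h with h | h <;> simp [h]
  have e : elephantCharFun μ p q X 1 t = Complex.exp ((-(t * (2 * q - 1)) : ℝ) * Complex.I) *
      (Real.cos t + ((2 * q - 1 : ℝ) : ℂ) * Real.sin t * Complex.I) := by
    have e1 : elephantCharFun μ p q X 1 t =
        ∫ ω, Complex.exp ((-(t * (2 * q - 1)) : ℝ) * Complex.I) *
          (Real.cos t + X 1 ω * (Real.sin t * Complex.I)) ∂μ := by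
      rw [elephantCharFun, if_neg one_ne_zero, elephantA_one p hp]
      refine integral_congr_ae ?_
      filter_upwards [hw.ae_step le_rfl] with ω h
      have e2 : t * (1 * elephantPosition X 1 ω - (2 * q - 1)) =
          -(t * (2 * q - 1)) + t * X 1 ω := by
        simp [elephantPosition]
        ring
      rw [e2, Complex.ofReal_add, add_mul, Complex.exp_add, exp_mul_I_of_eq_one_or_eq_neg_one h]
      ring
    rw [e1, integral_const_mul, integral_add (integrable_const _) (hXi.mul_const _),
      integral_mul_const, integral_complex_ofReal (f := X 1),
      integral_of_eq_one_or_eq_neg_one (hw.measurable_step 1) hw.first_step_pos hw.first_step_neg]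
    simp
    ring
  rw [e]
  refine (norm_exp_mul_cos_add_sin_sub_cos_le t _ hc).trans ?_
  have h2 : (2 * q - 1) ^ 2 ≤ 1 := by rw [← sq_abs]; exact pow_le_one₀ (abs_nonneg _) hc
  have h3 : 4 * t ^ 2 * (2 * q - 1) ^ 2 ≤ 4 * t ^ 2 * 1 := by gcongr
  have h4 : |t| ^ 3 * |2 * q - 1| ≤ |t| ^ 3 * 1 := by gcongr
  linarith

theorem norm_charFun_succ_sub_le (hw : IsElephantWalk μ p q X α β) (hp : 0 < p)
    (hp1 : p ≤ 1) (hq : 0 ≤ q) (hq1 : q ≤ 1) (n : ℕ) (t : ℝ) :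
    ‖elephantCharFun μ p q X (n + 1) t -
        Real.cos (t * elephantA p (n + 1)) * elephantCharFun μ p q X n t‖ ≤
      4 * (t * elephantA p (n + 1)) ^ 2 * elephantDrift p n +
        |t * elephantA p (n + 1)| ^ 3 * √(elephantDrift p n) := by
  rcases Nat.eq_zero_or_pos n with rfl | hn
  · have := hw.norm_charFun_one_sub_le hp hq hq1 t
    have e : elephantCharFun μ p q X 0 t = 1 := by simp [elephantCharFun]
    rw [e, zero_add, elephantA_one p hp]
    simpa [elephantDrift] using this
  · exact hw.norm_charFun_succ_sub_le_of_one_le hp hp1 hn t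

end IsElephantWalk
end

theorem abs_cos_le_exp_neg {τ : ℝ} (h : |τ| ≤ 1) : |Real.cos τ| ≤ Real.exp (-(τ ^ 2 / 4)) := by
  have h1 := abs_le.1 (Real.cos_bound h)
  have h2 : |τ| ^ 4 ≤ τ ^ 2 := by
    rw [← sq_abs τ]
    exact pow_le_pow_of_le_one (abs_nonneg _) h (by norm_num)
  have h3 : τ ^ 2 ≤ 1 := by rw [← sq_abs]; exact pow_le_one₀ (abs_nonneg _) h
  have h4 := Real.add_one_le_exp (-(τ ^ 2 / 4))
  rw [abs_of_nonneg (by linarith [h1.1])]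
  linarith [h1.2, sq_nonneg τ]

theorem exp_neg_le_one_sub_half {y : ℝ} (h0 : 0 ≤ y) (h1 : y ≤ 1) :
    Real.exp (-y) ≤ 1 - y / 2 := by
  rw [Real.exp_neg]
  refine (inv_le_of_inv_le₀ (by linarith) ?_)
  refine le_trans ?_ (Real.add_one_le_exp y)
  rw [inv_le_iff_one_le_mul₀ (by linarith)]
  nlinarith

theorem abs_cos_sub_exp_le (τ : ℝ) :
    |Real.cos τ - Real.exp (-(τ ^ 2 / 2))| ≤ 2 * (τ ^ 2) ^ 2 := by
  rcases le_total |τ| 1 with h | h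
  · have h1 := Real.cos_bound h
    have h3 : τ ^ 2 ≤ 1 := by rw [← sq_abs]; exact pow_le_one₀ (abs_nonneg _) h
    have h2 := Real.norm_exp_sub_one_sub_id_le (x := -(τ ^ 2 / 2)) (by
      rw [Real.norm_eq_abs, abs_neg, abs_of_nonneg (by positivity)]
      linarith)
    rw [Real.norm_eq_abs, Real.norm_eq_abs, sq_abs] at h2
    have h4 : |τ| ^ 4 = (τ ^ 2) ^ 2 := by rw [← sq_abs τ]; ring
    rw [h4] at h1
    rw [abs_le] at h1 h2 ⊢
    have := sq_nonneg (τ ^ 2)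
    constructor <;> linarith [h1.1, h1.2, h2.1, h2.2]
  · have h1 : 1 ≤ τ ^ 2 := by rw [← sq_abs]; exact one_le_pow₀ h
    have h2 : Real.exp (-(τ ^ 2 / 2)) ≤ 1 := Real.exp_le_one_iff.2 (by linarith)
    have h3 := Real.exp_pos (-(τ ^ 2 / 2))
    have h4 := Real.cos_le_one τ
    have h5 := Real.neg_one_le_cos τ
    rw [abs_le]
    constructor <;> nlinarith

theorem min_mul_exp_add_le {x w : ℝ} (hx0 : 0 ≤ x) (hx1 : x ≤ 1) (hw : 0 ≤ w) :
    min 8 w * Real.exp (-(x / 4)) + x ≤ min 8 (w + x) := by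
  have h1 := exp_neg_le_one_sub_half (y := x / 4) (by linarith) (by linarith)
  have h2 : Real.exp (-(x / 4)) ≤ 1 := Real.exp_le_one_iff.2 (by linarith)
  have h3 := Real.exp_pos (-(x / 4))
  refine le_min ?_ ?_
  · have : min 8 w * Real.exp (-(x / 4)) ≤ 8 * (1 - x / 4 / 2) := by
      gcongr
      exact min_le_left _ _
    linarith
  · have : min 8 w * Real.exp (-(x / 4)) ≤ w * 1 := by
      gcongr
      exact min_le_right _ _
    linarith

/-- If `ψ k` satisfies up to small errors the recursion of the characteristic functions of a
weighted sum of symmetric signs, then `ψ n` is close to the Gaussian characteristic function. -/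
theorem norm_sub_exp_le_of_norm_succ_sub_cos_mul_le {a V e : ℕ → ℝ} {ψ : ℕ → ℂ} {t : ℝ}
    (hV0 : V 0 = 0) (hV : ∀ k, V (k + 1) = V k + a (k + 1) ^ 2) (he : ∀ k, 0 ≤ e k)
    (hψ0 : ψ 0 = 1)
    (hψ : ∀ k, ‖ψ (k + 1) - Real.cos (t * a (k + 1)) * ψ k‖ ≤
      4 * (t * a (k + 1)) ^ 2 * e k + |t * a (k + 1)| ^ 3 * √(e k))
    {n K : ℕ} (hKn : K ≤ n) (hK : V K ≤ V n / 2)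
    (hsmall : ∀ k, K ≤ k → k < n → |t * a (k + 1)| ≤ 1) {η s : ℝ}
    (hs : s = |t| * √(V n))
    (hη0 : 0 ≤ η) (hη : ∀ k, K ≤ k → k < n → e k ≤ η ∧ |a (k + 1)| * √(e k) ≤ √(V n) * η) :
    ‖ψ n - Real.exp (-(t ^ 2 * V n / 2))‖ ≤
      (5 * (∑ k ∈ Finset.range n, (t * a (k + 1)) ^ 2 * e k) +
        7 * ∑ k ∈ Finset.range n, ((t * a (k + 1)) ^ 2) ^ 2) * Real.exp (-(s ^ 2 / 8)) +
      20 * η * s := by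
  set x : ℕ → ℝ := fun k => (t * a (k + 1)) ^ 2 with hx
  have hx0 : ∀ k, 0 ≤ x k := fun k => sq_nonneg _
  have hVnn : ∀ k, 0 ≤ V k := fun k => by
    induction k with
    | zero => rw [hV0]
    | succ k ih => rw [hV]; positivity
  have hs0 : 0 ≤ s := by rw [hs]; positivity
  have hs2 : t ^ 2 * V n = s ^ 2 := by
    rw [hs, mul_pow, sq_abs, Real.sq_sqrt (hVnn n)]
  have hVx : ∀ k, t ^ 2 * V (k + 1) = t ^ 2 * V k + x k := fun k => by
    rw [hV, hx]; ring
  set G : ℕ → ℝ := fun k => Real.exp (-(t ^ 2 * V k / 2)) with hG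
  have hG1 : ∀ k, G k ≤ 1 := fun k => Real.exp_le_one_iff.2 (by
    have := hVnn k
    have : 0 ≤ t ^ 2 * V k := by positivity
    linarith)
  have hG0 : ∀ k, 0 < G k := fun k => Real.exp_pos _
  have hx3 : ∀ k, |t * a (k + 1)| ^ 3 = x k * |t * a (k + 1)| := fun k => by
    simp only [hx]; rw [← sq_abs (t * a (k + 1))]; ring
  have hrec : ∀ k, ‖ψ (k + 1) - G (k + 1)‖ ≤ |Real.cos (t * a (k + 1))| * ‖ψ k - G k‖ +
      (4 * x k * e k + x k * |t * a (k + 1)| * √(e k) + 2 * x k ^ 2 * G k) := by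
    intro k
    have e1 : ψ (k + 1) - G (k + 1) = Real.cos (t * a (k + 1)) * (ψ k - G k) +
        ((ψ (k + 1) - Real.cos (t * a (k + 1)) * ψ k) +
          (((Real.cos (t * a (k + 1)) - Real.exp (-(x k / 2))) * G k : ℝ) : ℂ)) := by
      have : G (k + 1) = Real.exp (-(x k / 2)) * G k := by
        simp only [hG]
        rw [← Real.exp_add, hVx]
        congr 1
        ring
      rw [this]
      push_cast
      ring
    rw [e1]
    refine (norm_add_le _ _).trans ?_
    rw [norm_mul, Complex.norm_real, Real.norm_eq_abs]
    gcongr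
    refine (norm_add_le _ _).trans ?_
    rw [Complex.norm_real, Real.norm_eq_abs, abs_mul, abs_of_pos (hG0 k)]
    have h1 := hψ k
    rw [hx3] at h1
    have h2 := mul_le_mul_of_nonneg_right (abs_cos_sub_exp_le (t * a (k + 1))) (hG0 k).le
    linarith
  have hr1 : ∀ k, 4 * x k * e k + x k * |t * a (k + 1)| * √(e k) + 2 * x k ^ 2 * G k ≤
      5 * (x k * e k) + 3 * x k ^ 2 := by
    intro k
    have h1 : |t * a (k + 1)| * √(e k) ≤ (x k + e k) / 2 := by
      have := two_mul_le_add_sq (|t * a (k + 1)|) (√(e k))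
      rw [sq_abs, Real.sq_sqrt (he k)] at this
      linarith
    have h2 := mul_le_mul_of_nonneg_left h1 (hx0 k)
    have h3 := mul_le_mul_of_nonneg_left (hG1 k) (sq_nonneg (x k))
    have h4 := mul_nonneg (hx0 k) (he k)
    nlinarith [sq_nonneg (x k)]
  have hphase1 : ∀ k, ‖ψ k - G k‖ ≤ ∑ j ∈ Finset.range k, (5 * (x j * e j) + 3 * x j ^ 2) := by
    intro k
    induction k with
    | zero => simp [hψ0, hG, hV0]
    | succ k ih =>
      rw [Finset.sum_range_succ]
      have h1 := hrec k
      have h2 := mul_le_of_le_one_left (norm_nonneg (ψ k - G k))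
        (Real.abs_cos_le_one (t * a (k + 1)))
      linarith [hr1 k]
  set R := ∑ j ∈ Finset.range K, (5 * (x j * e j) + 3 * x j ^ 2) with hR
  have hR0 : 0 ≤ R := Finset.sum_nonneg fun j _ => by
    have := mul_nonneg (hx0 j) (he j)
    positivity
  have hphase2 : ∀ k, K ≤ k → k ≤ n → ‖ψ k - G k‖ ≤
      R * Real.exp (-(t ^ 2 * (V k - V K) / 4)) + η * (4 + s) * min 8 (t ^ 2 * V k) +
        4 * (∑ j ∈ Finset.range k, x j ^ 2) * Real.exp (-(t ^ 2 * V k / 4)) := by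
    intro k hk
    induction k, hk using Nat.le_induction with
    | base =>
      intro _
      have h1 := hphase1 K
      have h2 : 0 ≤ η * (4 + s) * min 8 (t ^ 2 * V K) := by
        have := hVnn K
        positivity
      have h3 : 0 ≤ 4 * (∑ j ∈ Finset.range K, x j ^ 2) * Real.exp (-(t ^ 2 * V K / 4)) := by
        positivity
      simp only [sub_self, mul_zero, zero_div, neg_zero, Real.exp_zero, mul_one]
      linarith
    | succ k hk ih =>
      intro hkn
      have ih := ih (by omega)
      have hsm := hsmall k hk (by omega)
      have hx1 : x k ≤ 1 := by
        simp only [hx]; rw [← sq_abs]; exact pow_le_one₀ (abs_nonneg _) hsm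
      obtain ⟨he1, he2⟩ := hη k hk (by omega)
      have hc := abs_cos_le_exp_neg hsm
      have hcx : |Real.cos (t * a (k + 1))| ≤ Real.exp (-(x k / 4)) := hc
      have hE := Real.exp_pos (-(x k / 4))
      have h1 := mul_le_mul hcx ih (norm_nonneg _) hE.le
      have e1 : Real.exp (-(t ^ 2 * (V (k + 1) - V K) / 4)) =
          Real.exp (-(x k / 4)) * Real.exp (-(t ^ 2 * (V k - V K) / 4)) := by
        rw [← Real.exp_add]
        congr 1
        linarith [hVx k]
      have e2 : Real.exp (-(t ^ 2 * V (k + 1) / 4)) =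
          Real.exp (-(x k / 4)) * Real.exp (-(t ^ 2 * V k / 4)) := by
        rw [← Real.exp_add]
        congr 1
        linarith [hVx k]
      have h2 := min_mul_exp_add_le (hx0 k) hx1 (mul_nonneg (sq_nonneg t) (hVnn k))
      rw [← hVx] at h2
      have h2' := mul_le_mul_of_nonneg_left h2 (mul_nonneg hη0 (by linarith : 0 ≤ 4 + s))
      have h3 : |t * a (k + 1)| * √(e k) ≤ s * η := by
        rw [abs_mul, hs]
        have := mul_le_mul_of_nonneg_left he2 (abs_nonneg t)
        linarith
      have h3' := mul_le_mul_of_nonneg_left h3 (hx0 k)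
      have h4' := mul_le_mul_of_nonneg_left he1 (hx0 k)
      have h5 : G k ≤ 2 * Real.exp (-(t ^ 2 * V (k + 1) / 4)) := by
        rw [e2]
        have h6 : (1 : ℝ) / 2 ≤ Real.exp (-(x k / 4)) := by
          have := Real.add_one_le_exp (-(x k / 4))
          linarith
        have h7 : G k ≤ Real.exp (-(t ^ 2 * V k / 4)) := by
          simp only [hG]
          refine Real.exp_le_exp.2 ?_
          have := mul_nonneg (sq_nonneg t) (hVnn k)
          linarith
        have h8 := mul_le_mul_of_nonneg_right h6 (Real.exp_pos (-(t ^ 2 * V k / 4))).le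
        linarith
      have h5' := mul_le_mul_of_nonneg_left h5 (sq_nonneg (x k))
      rw [Finset.sum_range_succ, e1]
      have h9 := hrec k
      have e3 : (∑ j ∈ Finset.range k, x j ^ 2) * Real.exp (-(t ^ 2 * V (k + 1) / 4)) =
        (∑ j ∈ Finset.range k, x j ^ 2) *
          (Real.exp (-(x k / 4)) * Real.exp (-(t ^ 2 * V k / 4))) := by rw [e2]
      linarith
  have hfin := hphase2 n hKn le_rfl
  rw [hs2] at hfin
  have h1 : Real.exp (-(t ^ 2 * (V n - V K) / 4)) ≤ Real.exp (-(s ^ 2 / 8)) := by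
    refine Real.exp_le_exp.2 ?_
    have := mul_le_mul_of_nonneg_left hK (sq_nonneg t)
    rw [← hs2]
    linarith
  have h2 : Real.exp (-(s ^ 2 / 4)) ≤ Real.exp (-(s ^ 2 / 8)) :=
    Real.exp_le_exp.2 (by linarith [sq_nonneg s])
  have h3 : (4 + s) * min 8 (s ^ 2) ≤ 20 * s := by
    have h4 : min 8 (s ^ 2) ≤ 3 * s := by
      rcases le_total s 3 with h | h
      · exact (min_le_right _ _).trans (by nlinarith)
      · exact (min_le_left _ _).trans (by linarith)
    have h5 : s * min 8 (s ^ 2) ≤ s * 8 := by gcongr; exact min_le_left _ _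
    linarith
  have h3' := mul_le_mul_of_nonneg_left h3 hη0
  have hRle : R ≤ 5 * (∑ k ∈ Finset.range n, x k * e k) +
      3 * ∑ k ∈ Finset.range n, x k ^ 2 := by
    rw [Finset.mul_sum, Finset.mul_sum, ← Finset.sum_add_distrib]
    refine Finset.sum_le_sum_of_subset_of_nonneg (Finset.range_mono hKn) fun j _ _ => ?_
    have := mul_nonneg (hx0 j) (he j)
    positivity
  have hS0 : 0 ≤ ∑ k ∈ Finset.range n, x k ^ 2 := Finset.sum_nonneg fun k _ => sq_nonneg _
  have h6 := mul_le_mul_of_nonneg_left h1 hR0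
  have h7 := mul_le_mul_of_nonneg_left h2 hS0
  have h8 := mul_le_mul_of_nonneg_right hRle (Real.exp_pos (-(s ^ 2 / 8))).le
  have h9 : ‖ψ n - G n‖ ≤ (5 * (∑ k ∈ Finset.range n, x k * e k) +
        7 * ∑ k ∈ Finset.range n, x k ^ 2) * Real.exp (-(s ^ 2 / 8)) + 20 * η * s := by
    linarith
  simpa [hG, hs2] using h9

theorem poly_mul_exp_neg_sq_le {u : ℝ} (hu : 0 ≤ u) :
    (u + u ^ 3) * Real.exp (-(u ^ 2 / 8)) ≤ 20000 * (1 + u ^ 2)⁻¹ := by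
  rw [Real.exp_neg, ← div_eq_mul_inv, ← div_eq_mul_inv,
    div_le_div_iff₀ (Real.exp_pos _) (by positivity)]
  have h1 := Real.pow_div_factorial_le_exp (u ^ 2 / 8) (by positivity) 3
  have h2 := Real.one_le_exp (show 0 ≤ u ^ 2 / 8 by positivity)
  have h3 : (u ^ 2 / 8) ^ 3 / (Nat.factorial 3 : ℝ) = u ^ 6 / 3072 := by
    rw [show Nat.factorial 3 = 6 from rfl]
    push_cast
    ring
  rw [h3] at h1
  have h4 : u ≤ 1 + u ^ 6 := by
    rcases le_total u 1 with h | h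
    · have : 0 ≤ u ^ 6 := by positivity
      linarith
    · have := le_self_pow₀ h (show 6 ≠ 0 by norm_num)
      linarith
  have h5 : u ^ 5 ≤ 1 + u ^ 6 := by
    rcases le_total u 1 with h | h
    · have := pow_le_one₀ (n := 5) hu h
      have : 0 ≤ u ^ 6 := by positivity
      linarith
    · have := pow_le_pow_right₀ h (show 5 ≤ 6 by norm_num)
      linarith
  have h6 : u ^ 3 ≤ 1 + u ^ 6 := by
    nlinarith [sq_nonneg (u ^ 3 - 1)]
  nlinarith

theorem kolmogorovDist_le {Ω : Type*} [MeasurableSpace Ω] {μ : Measure Ω} {Y : Ω → ℝ} {B : ℝ}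
    [IsProbabilityMeasure μ] (hY : Measurable Y)
    (h : ∀ u, |cdf (μ.map Y) u - cdf (gaussianReal 0 1) u| ≤ B) : kolmogorovDist μ Y ≤ B := by
  refine ciSup_le fun u => ?_
  have := Measure.isProbabilityMeasure_map (μ := μ) hY.aemeasurable
  have := h u
  rw [cdf_eq_real (μ.map Y), map_measureReal_apply hY measurableSet_Iic] at this
  exact this

theorem kolmogorovDist_le_one {Ω : Type*} [MeasurableSpace Ω] {μ : Measure Ω} {Y : Ω → ℝ}
    [IsProbabilityMeasure μ] (hY : Measurable Y) : kolmogorovDist μ Y ≤ 1 := by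
  refine kolmogorovDist_le hY fun u => ?_
  have h1 := cdf_nonneg (μ.map Y) u
  have h2 := cdf_le_one (μ.map Y) u
  have h3 := cdf_nonneg (gaussianReal 0 1) u
  have h4 := cdf_le_one (gaussianReal 0 1) u
  rw [abs_le]
  constructor <;> linarith

theorem IsElephantWalk.charFun_map_eq {Ω : Type*} [MeasurableSpace Ω] {μ : Measure Ω}
    [IsProbabilityMeasure μ] {p q : ℝ} {X α : ℕ → Ω → ℝ} {β : ℕ → Ω → ℕ} (hw : IsElephantWalk μ p q X α β)
    {n : ℕ} (hn : 1 ≤ n) (v u : ℝ) :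
    charFun (μ.map fun ω => (elephantA p n * elephantPosition X n ω - (2 * q - 1)) / v) u =
      elephantCharFun μ p q X n (u / v) := by
  have hm : Measurable fun ω => (elephantA p n * elephantPosition X n ω - (2 * q - 1)) / v :=
    (((hw.measurable_position n).const_mul _).sub_const _).div_const _
  rw [charFun_apply_real, integral_map hm.aemeasurable
    (Continuous.aestronglyMeasurable (by fun_prop)), elephantCharFun, if_neg (by omega)]
  congr 1
  funext ω
  congr 2
  push_cast
  ring

theorem elephantV_zero (p : ℝ) : elephantV p 0 = 0 := by simp [elephantV]

/-- Berry–Esseen bound for the elephant random walk in terms of the normalizing sequences. The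
times are split at `K`, and `T` is the range of frequencies used in the smoothing inequality. -/
theorem exists_kolmogorovDist_elephant_le : ∃ C : ℝ, 0 < C ∧
    ∀ (Ω : Type*) [MeasurableSpace Ω] (μ : Measure Ω) [IsProbabilityMeasure μ]
      (p q : ℝ) (X α : ℕ → Ω → ℝ) (β : ℕ → Ω → ℕ) (_ : IsElephantWalk μ p q X α β)
      (_ : 0 < p) (_ : p ≤ 1) (_ : 0 ≤ q) (_ : q ≤ 1)
      (n K : ℕ) (_ : 1 ≤ n) (_ : K ≤ n) (_ : elephantV p K ≤ elephantV p n / 2)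
      (T η : ℝ) (_ : 0 < T) (_ : 0 ≤ η)
      (_ : ∀ k, K ≤ k → k < n → T * elephantA p (k + 1) ≤ √(elephantV p n))
      (_ : ∀ k, K ≤ k → k < n → elephantDrift p k ≤ η ∧
        elephantA p (k + 1) * √(elephantDrift p k) ≤ √(elephantV p n) * η),
      kolmogorovDist μ (fun ω =>
          (elephantA p n * elephantPosition X n ω - (2 * q - 1)) / √(elephantV p n)) ≤
        C * ((∑ k ∈ Finset.range n, elephantA p (k + 1) ^ 2 * elephantDrift p k) / elephantV p n +
          (∑ k ∈ Finset.range n, elephantA p (k + 1) ^ 4) / elephantV p n ^ 2 + η * T + 1 / T) := by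
  obtain ⟨C, hC, H⟩ := exists_cdf_sub_gaussianReal_le_of_charFun
  refine ⟨C * 1000000, by positivity, ?_⟩
  intro Ω _ μ _ p q X α β hw hp hp1 hq hq1 n K hn hKn hK T η hT hη0 hsm hη
  set v := elephantV p n with hv
  have hv1 : 1 ≤ v := one_le_elephantV hp hn
  have hv0 : 0 < v := by linarith
  have hsv : 0 < √v := Real.sqrt_pos.2 hv0
  have hm : Measurable fun ω =>
      (elephantA p n * elephantPosition X n ω - (2 * q - 1)) / √v :=
    (((hw.measurable_position n).const_mul _).sub_const _).div_const _
  have := Measure.isProbabilityMeasure_map (μ := μ) hm.aemeasurable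
  refine kolmogorovDist_le hm fun x => ?_
  set B₁ := (∑ k ∈ Finset.range n, elephantA p (k + 1) ^ 2 * elephantDrift p k) / v with hB₁
  set B₂ := (∑ k ∈ Finset.range n, elephantA p (k + 1) ^ 4) / v ^ 2 with hB₂
  have hB₁0 : 0 ≤ B₁ := div_nonneg (Finset.sum_nonneg fun k _ =>
    mul_nonneg (sq_nonneg _) (elephantDrift_nonneg p k)) hv0.le
  have hB₂0 : 0 ≤ B₂ := div_nonneg (Finset.sum_nonneg fun k _ => by positivity) (by positivity)
  set h : ℝ → ℝ := fun u => 140000 * (B₁ + B₂) * (1 + u ^ 2)⁻¹ + 20 * η with hh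
  have hc1 : Continuous fun u : ℝ => (1 + u ^ 2)⁻¹ :=
    Continuous.inv₀ (by fun_prop) fun u => by positivity
  have key := H (μ.map fun ω =>
      (elephantA p n * elephantPosition X n ω - (2 * q - 1)) / √v) T hT h (by fun_prop)
    (fun u => by positivity) (fun u hu => ?_) x
  · refine key.trans ?_
    have hint : ∫ t in (-T)..T, h t ≤ 140000 * (B₁ + B₂) * 4 + 40 * (η * T) := by
      rw [hh, intervalIntegral.integral_add ((hc1.const_mul _).intervalIntegrable _ _)
        (by simp), intervalIntegral.integral_const_mul, integral_inv_one_add_sq,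
        intervalIntegral.integral_const, smul_eq_mul]
      have h1 : Real.arctan T - Real.arctan (-T) ≤ 4 := by
        have := Real.arctan_lt_pi_div_two T
        have := Real.neg_pi_div_two_lt_arctan (-T)
        linarith [Real.pi_le_four]
      have h2 : 140000 * (B₁ + B₂) * (Real.arctan T - Real.arctan (-T)) ≤
        140000 * (B₁ + B₂) * 4 := by gcongr
      linarith
    have h3 : 0 ≤ η * T := by positivity
    have h4 : 0 < 1 / T := by positivity
    rw [mul_assoc]
    gcongr
    linarith
  · rw [hw.charFun_map_eq hn, charFun_gaussianReal]
    set t := u / √v with ht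
    have ht2 : t ^ 2 * v = u ^ 2 := by
      rw [ht, div_pow, Real.sq_sqrt hv0.le, div_mul_cancel₀ _ hv0.ne']
    have hs : |u| = |t| * √v := by
      rw [ht, abs_div, abs_of_pos hsv, div_mul_cancel₀ _ hsv.ne']
    have main := norm_sub_exp_le_of_norm_succ_sub_cos_mul_le (a := elephantA p)
      (V := elephantV p) (e := elephantDrift p) (ψ := fun k => elephantCharFun μ p q X k t) (t := t)
      (elephantV_zero p) (elephantV_succ p) (elephantDrift_nonneg p) (by simp [elephantCharFun])
      (fun k => hw.norm_charFun_succ_sub_le hp hp1 hq hq1 k t) hKn hK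
      (fun k hk hkn => by
        have ha := elephantA_pos hp (show 1 ≤ k + 1 by omega)
        rw [abs_mul, abs_of_pos ha]
        have h1 : |t| * √v ≤ T := hs ▸ hu
        have h2 : |t| * √v * elephantA p (k + 1) ≤ √v := by
          refine le_trans ?_ (hsm k hk hkn)
          gcongr
        have h3 : (|t| * elephantA p (k + 1)) * √v ≤ 1 * √v := by linarith
        exact le_of_mul_le_mul_right h3 hsv)
      hs hη0 (fun k hk hkn => by
        have ha := elephantA_pos hp (show 1 ≤ k + 1 by omega)
        rw [abs_of_pos ha]
        exact hη k hk hkn)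
    have e1 : ∑ k ∈ Finset.range n, (t * elephantA p (k + 1)) ^ 2 * elephantDrift p k =
        |u| ^ 2 * B₁ := by
      rw [hB₁, sq_abs, ← ht2, mul_assoc, mul_div_cancel₀ _ hv0.ne', Finset.mul_sum]
      exact Finset.sum_congr rfl fun k _ => by ring
    have e2 : ∑ k ∈ Finset.range n, ((t * elephantA p (k + 1)) ^ 2) ^ 2 = |u| ^ 4 * B₂ := by
      rw [hB₂, show |u| ^ 4 = (t ^ 2) ^ 2 * v ^ 2 by rw [← mul_pow, ht2, ← sq_abs u]; ring,
        mul_assoc, mul_div_cancel₀ _ (by positivity), Finset.mul_sum]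
      exact Finset.sum_congr rfl fun k _ => by ring
    rw [e1, e2] at main
    have e3 : Complex.exp (u * (0 : ℝ) * Complex.I - (1 : NNReal) * u ^ 2 / 2) =
        (Real.exp (-(t ^ 2 * elephantV p n / 2)) : ℂ) := by
      rw [← hv, ht2]
      push_cast
      congr 1
      simp
    rw [e3]
    refine main.trans ?_
    have hu0 := abs_nonneg u
    have h1 := poly_mul_exp_neg_sq_le hu0
    have hE := Real.exp_pos (-(|u| ^ 2 / 8))
    have h2 : (5 * (|u| ^ 2 * B₁) + 7 * (|u| ^ 4 * B₂)) * Real.exp (-(|u| ^ 2 / 8)) ≤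
        |u| * (7 * (B₁ + B₂)) * ((|u| + |u| ^ 3) * Real.exp (-(|u| ^ 2 / 8))) := by
      rw [← mul_assoc (|u| * (7 * (B₁ + B₂)))]
      refine mul_le_mul_of_nonneg_right ?_ hE.le
      have h3 : 0 ≤ |u| ^ 2 * B₁ := by positivity
      have h4 : 0 ≤ |u| ^ 2 * B₂ := by positivity
      have h5 : 0 ≤ |u| ^ 4 * B₁ := by positivity
      linarith
    have h3 : |u| * (7 * (B₁ + B₂)) * ((|u| + |u| ^ 3) * Real.exp (-(|u| ^ 2 / 8))) ≤
        |u| * (7 * (B₁ + B₂)) * (20000 * (1 + |u| ^ 2)⁻¹) := by gcongr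
    rw [hh]
    rw [sq_abs] at h2 h3 ⊢
    simp only [sq_abs] at *
    linarith

theorem exists_pos_bounds_of_tendsto {u : ℕ → ℝ} {l : ℝ} (hu : ∀ n, 0 < u n) (hl : 0 < l)
    (h : Tendsto u atTop (𝓝 l)) : ∃ c C : ℝ, 0 < c ∧ 0 < C ∧ ∀ n, c ≤ u n ∧ u n ≤ C := by
  obtain ⟨C, hC⟩ := h.bddAbove_range
  obtain ⟨D, hD⟩ := (h.inv₀ hl.ne').bddAbove_range
  have hC' : ∀ n, u n ≤ C := fun n => hC ⟨n, rfl⟩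
  have hD' : ∀ n, (u n)⁻¹ ≤ D := fun n => hD ⟨n, rfl⟩
  have hD0 : 0 < D := (inv_pos.2 (hu 0)).trans_le (hD' 0)
  exact ⟨D⁻¹, C, inv_pos.2 hD0, (hu 0).trans_le (hC' 0), fun n =>
    ⟨inv_le_of_inv_le₀ (hu n) (hD' n), hC' n⟩⟩

theorem elephantA_add_two {p : ℝ} (hp : 0 < p) (n : ℕ) :
    elephantA p (n + 2) = (n + 1).factorial / ∏ j ∈ Finset.range (n + 1), (2 * p + j) := by
  have hprod : ∀ n : ℕ, ∏ j ∈ Finset.range n, (2 * p + (j : ℝ)) ≠ 0 := fun n =>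
    (Finset.prod_pos fun j _ => by positivity).ne'
  have hrec : ∀ n : ℕ, elephantA p (n + 2) = elephantA p (n + 1) * ((n + 1) / (2 * p + n)) := by
    intro n
    have h := elephantA_succ_mul hp (show 1 ≤ n + 1 by omega)
    rw [← h]
    have : (2 * p + n : ℝ) ≠ 0 := by positivity
    have h2 : ((n : ℝ) + 1) ≠ 0 := by positivity
    push_cast
    field_simp
    ring
  induction n with
  | zero =>
    rw [hrec, elephantA_one p hp]
    simp
  | succ n ih =>
    rw [hrec, ih, Finset.prod_range_succ _ (n + 1), Nat.factorial_succ (n + 1)]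
    have := hprod (n + 1)
    have h3 : (2 * p + (n + 1 : ℕ) : ℝ) ≠ 0 := by positivity
    push_cast at *
    field_simp

theorem exists_elephantA_sq_bounds {p : ℝ} (hp : 0 < p) : ∃ c C : ℝ, 0 < c ∧ 0 < C ∧
    ∀ k : ℕ, 1 ≤ k → c * (k : ℝ) ^ (2 - 4 * p) ≤ elephantA p k ^ 2 ∧
      elephantA p k ^ 2 ≤ C * (k : ℝ) ^ (2 - 4 * p) := by
  set u : ℕ → ℝ := fun k => elephantA p (k + 1) ^ 2 / ((k + 1 : ℕ) : ℝ) ^ (2 - 4 * p) with hu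
  have hlim : Tendsto u atTop (𝓝 (Real.Gamma (2 * p) ^ 2)) := by
    rw [← tendsto_add_atTop_iff_nat 1]
    have h1 := ((Real.GammaSeq_tendsto_Gamma (2 * p)).pow 2)
    have h2 : Tendsto (fun n : ℕ => (1 + 1 * (n : ℝ)⁻¹) ^ 2 *
        (1 + 2 * (n : ℝ)⁻¹) ^ (4 * p - 2)) atTop (𝓝 1) := by
      have h3 := tendsto_inv_atTop_nhds_zero_nat (𝕜 := ℝ)
      have h4 := ((h3.const_mul 1).const_add 1).pow 2
      have h5 := ((h3.const_mul 2).const_add 1).rpow_const (p := 4 * p - 2) (Or.inl (by simp))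
      simpa using h4.mul h5
    have h6 := h1.mul h2
    rw [mul_one] at h6
    refine h6.congr' ?_
    filter_upwards [eventually_gt_atTop 0] with n hn
    have hn' : (0 : ℝ) < n := by exact_mod_cast hn
    simp only [hu]
    rw [elephantA_add_two hp, Real.GammaSeq]
    have hprod : ∏ j ∈ Finset.range (n + 1), (2 * p + (j : ℝ)) ≠ 0 :=
      (Finset.prod_pos fun j _ => by positivity).ne'
    have e1 : (1 + 2 * (n : ℝ)⁻¹) ^ (4 * p - 2) =
        ((n + 2 : ℝ) ^ (2 - 4 * p))⁻¹ * ((n : ℝ) ^ (4 * p - 2))⁻¹ := by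
      rw [show 1 + 2 * (n : ℝ)⁻¹ = (n + 2) / n by field_simp, Real.div_rpow (by positivity) hn'.le,
        ← Real.rpow_neg (by positivity) (2 - 4 * p), div_eq_mul_inv]
      congr 2
      ring
    have e2 : ((n : ℝ) ^ (2 * p)) ^ 2 = (n : ℝ) ^ (4 * p - 2) * n ^ 2 := by
      rw [← Real.rpow_natCast, ← Real.rpow_natCast, ← Real.rpow_mul hn'.le, ← Real.rpow_add hn']
      congr 1
      push_cast
      ring
    have h7 : (n : ℝ) ^ (4 * p - 2) ≠ 0 := (Real.rpow_pos_of_pos hn' _).ne'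
    have h8 : (n + 2 : ℝ) ^ (2 - 4 * p) ≠ 0 := (Real.rpow_pos_of_pos (by positivity) _).ne'
    rw [e1, div_pow, mul_pow, e2, Nat.factorial_succ]
    push_cast
    rw [show (n : ℝ) + 1 + 1 = n + 2 by ring]
    field_simp
  have hg := Real.Gamma_pos_of_pos (show (0 : ℝ) < 2 * p by linarith)
  have hupos : ∀ k, 0 < u k := fun k => by
    have := elephantA_pos hp (show 1 ≤ k + 1 by omega)
    simp only [hu]
    positivity
  obtain ⟨c, C, hc, hC, h⟩ := exists_pos_bounds_of_tendsto hupos (by positivity) hlim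
  refine ⟨c, C, hc, hC, fun k hk => ?_⟩
  obtain ⟨m, rfl⟩ : ∃ m, k = m + 1 := ⟨k - 1, by omega⟩
  have hpow : 0 < ((m + 1 : ℕ) : ℝ) ^ (2 - 4 * p) := Real.rpow_pos_of_pos (by positivity) _
  obtain ⟨h1, h2⟩ := h m
  exact ⟨(le_div_iff₀ hpow).1 h1, (div_le_iff₀ hpow).1 h2⟩

theorem rpow_succ_sub_rpow_bounds {γ : ℝ} (hγ : 0 < γ) (k : ℕ) :
    min γ 1 * ((k + 1 : ℕ) : ℝ) ^ (γ - 1) ≤ ((k + 1 : ℕ) : ℝ) ^ γ - (k : ℝ) ^ γ ∧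
      ((k + 1 : ℕ) : ℝ) ^ γ - (k : ℝ) ^ γ ≤ max γ 1 * ((k + 1 : ℕ) : ℝ) ^ (γ - 1) := by
  set m : ℝ := ((k + 1 : ℕ) : ℝ) with hm
  have hm1 : 1 ≤ m := by rw [hm]; push_cast; linarith [Nat.cast_nonneg (α := ℝ) k]
  have hm0 : 0 < m := by linarith
  have hinv : m⁻¹ ≤ 1 := inv_le_one_of_one_le₀ hm1
  have hk : (k : ℝ) ^ γ = m ^ γ * (1 + -m⁻¹) ^ γ := by
    rw [← Real.mul_rpow hm0.le (by linarith)]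
    congr 1
    rw [mul_add, mul_neg, mul_inv_cancel₀ hm0.ne', hm]
    push_cast
    ring
  have hpow : m ^ (γ - 1) = m ^ γ * m⁻¹ := by rw [Real.rpow_sub_one hm0.ne', div_eq_mul_inv]
  have hmp : 0 < m ^ γ := Real.rpow_pos_of_pos hm0 _
  have key : min γ 1 * m⁻¹ ≤ 1 - (1 + -m⁻¹) ^ γ ∧ 1 - (1 + -m⁻¹) ^ γ ≤ max γ 1 * m⁻¹ := by
    rcases le_total γ 1 with h | h
    · have h1 := rpow_one_add_le_one_add_mul_self (s := -m⁻¹) (by linarith) hγ.le h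
      have h2 := Real.rpow_le_rpow_of_exponent_ge_of_imp (x := 1 + -m⁻¹) (y := 1) (z := γ)
        (by linarith) (by linarith [inv_pos.2 hm0]) h (by intro _ h3; linarith)
      rw [Real.rpow_one] at h2
      rw [min_eq_left h, max_eq_right h]
      constructor <;> linarith
    · have h1 := one_add_mul_self_le_rpow_one_add (s := -m⁻¹) (by linarith) h
      have h2 := Real.rpow_le_rpow_of_exponent_ge_of_imp (x := 1 + -m⁻¹) (y := γ) (z := 1)
        (by linarith) (by linarith [inv_pos.2 hm0]) h (by intro _ h3; linarith)
      rw [Real.rpow_one] at h2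
      rw [min_eq_right h, max_eq_left h]
      constructor <;> linarith
  rw [hk, hpow]
  constructor
  · have := mul_le_mul_of_nonneg_left key.1 hmp.le
    linarith
  · have := mul_le_mul_of_nonneg_left key.2 hmp.le
    linarith

theorem sum_rpow_bounds {γ : ℝ} (hγ : 0 < γ) (n : ℕ) :
    min γ 1 * ∑ k ∈ Finset.Icc 1 n, (k : ℝ) ^ (γ - 1) ≤ (n : ℝ) ^ γ ∧
      (n : ℝ) ^ γ ≤ max γ 1 * ∑ k ∈ Finset.Icc 1 n, (k : ℝ) ^ (γ - 1) := by
  induction n with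
  | zero => simp [Real.zero_rpow hγ.ne']
  | succ n ih =>
    obtain ⟨h1, h2⟩ := rpow_succ_sub_rpow_bounds hγ n
    rw [Finset.sum_Icc_succ_top (by omega), mul_add, mul_add]
    constructor
    · linarith [ih.1]
    · linarith [ih.2]

theorem exists_elephantV_bounds {p : ℝ} (hp : 0 < p) (hp' : p < 3 / 4) :
    ∃ c C : ℝ, 0 < c ∧ 0 < C ∧ ∀ n : ℕ, c * (n : ℝ) ^ (3 - 4 * p) ≤ elephantV p n ∧
      elephantV p n ≤ C * (n : ℝ) ^ (3 - 4 * p) := by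
  obtain ⟨c, C, hc, hC, h⟩ := exists_elephantA_sq_bounds hp
  set γ := 3 - 4 * p with hγ
  have hγ0 : 0 < γ := by linarith
  have e : 2 - 4 * p = γ - 1 := by rw [hγ]; ring
  rw [e] at h
  have hmin : 0 < min γ 1 := lt_min hγ0 one_pos
  have hmax : 0 < max γ 1 := lt_max_of_lt_left hγ0
  refine ⟨c / max γ 1, C / min γ 1, by positivity, by positivity, fun n => ?_⟩
  obtain ⟨h1, h2⟩ := sum_rpow_bounds hγ0 n
  have h3 : c * ∑ k ∈ Finset.Icc 1 n, (k : ℝ) ^ (γ - 1) ≤ elephantV p n := by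
    rw [Finset.mul_sum]
    exact Finset.sum_le_sum fun k hk => (h k (Finset.mem_Icc.1 hk).1).1
  have h4 : elephantV p n ≤ C * ∑ k ∈ Finset.Icc 1 n, (k : ℝ) ^ (γ - 1) := by
    rw [Finset.mul_sum]
    exact Finset.sum_le_sum fun k hk => (h k (Finset.mem_Icc.1 hk).1).2
  constructor
  · rw [div_mul_eq_mul_div, div_le_iff₀ hmax]
    calc c * (n : ℝ) ^ γ ≤ c * (max γ 1 * ∑ k ∈ Finset.Icc 1 n, (k : ℝ) ^ (γ - 1)) := by gcongr
      _ = (c * ∑ k ∈ Finset.Icc 1 n, (k : ℝ) ^ (γ - 1)) * max γ 1 := by ring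
      _ ≤ _ := by gcongr
  · rw [div_mul_eq_mul_div, le_div_iff₀ hmin]
    calc elephantV p n * min γ 1 ≤
          (C * ∑ k ∈ Finset.Icc 1 n, (k : ℝ) ^ (γ - 1)) * min γ 1 := by gcongr
      _ = C * (min γ 1 * ∑ k ∈ Finset.Icc 1 n, (k : ℝ) ^ (γ - 1)) := by ring
      _ ≤ _ := by gcongr

theorem exists_elephantV_log_bounds : ∃ c C : ℝ, 0 < c ∧ 0 < C ∧
    ∀ n : ℕ, c * Real.log n ≤ elephantV (3 / 4) n ∧
      elephantV (3 / 4) n ≤ C * (1 + Real.log n) := by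
  obtain ⟨c, C, hc, hC, h⟩ := exists_elephantA_sq_bounds (p := 3 / 4) (by norm_num)
  have e : (2 - 4 * (3 / 4) : ℝ) = -1 := by norm_num
  rw [e] at h
  refine ⟨c, C, hc, hC, fun n => ?_⟩
  have hH : (harmonic n : ℝ) = ∑ k ∈ Finset.Icc 1 n, (k : ℝ) ^ (-1 : ℝ) := by
    rw [harmonic_eq_sum_Icc]
    push_cast
    exact Finset.sum_congr rfl fun k _ => (Real.rpow_neg_one _).symm
  have h3 : c * (harmonic n : ℝ) ≤ elephantV (3 / 4) n := by
    rw [hH, Finset.mul_sum]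
    exact Finset.sum_le_sum fun k hk => (h k (Finset.mem_Icc.1 hk).1).1
  have h4 : elephantV (3 / 4) n ≤ C * (harmonic n : ℝ) := by
    rw [hH, Finset.mul_sum]
    exact Finset.sum_le_sum fun k hk => (h k (Finset.mem_Icc.1 hk).1).2
  have h5 : Real.log n ≤ harmonic n := by
    rcases Nat.eq_zero_or_pos n with rfl | hn
    · simp
    · refine le_trans (Real.log_le_log (by exact_mod_cast hn) ?_) (log_add_one_le_harmonic n)
      push_cast
      linarith
  exact ⟨(mul_le_mul_of_nonneg_left h5 hc.le).trans h3,
    h4.trans (mul_le_mul_of_nonneg_left (harmonic_le_one_add_log n) hC.le)⟩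

theorem elephantA_succ_le {p : ℝ} (hp : 0 < p) {k : ℕ} (hk : 1 ≤ k) :
    elephantA p (k + 1) ≤ (1 + 1 / (2 * p)) * elephantA p k := by
  have hk1 : (1 : ℝ) ≤ k := by exact_mod_cast hk
  have ha := elephantA_pos hp (show 1 ≤ k + 1 by omega)
  have hk0 : (0 : ℝ) < k := by linarith
  rw [← elephantA_succ_mul hp hk]
  have h : 1 ≤ (1 + 1 / (2 * p)) * (1 + (2 * p - 1) / k) := by
    have e : (1 + 1 / (2 * p)) * (1 + (2 * p - 1) / k) =
        (2 * p * k + (k - 1) + 4 * p ^ 2) / (2 * p * k) := by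
      field_simp
      ring
    rw [e, one_le_div (by positivity)]
    nlinarith [sq_nonneg p]
  nlinarith

theorem sum_range_elephantA_sq (p : ℝ) (n : ℕ) :
    ∑ k ∈ Finset.range n, elephantA p (k + 1) ^ 2 = elephantV p n := by
  induction n with
  | zero => simp [elephantV]
  | succ n ih => rw [Finset.sum_range_succ, ih, elephantV_succ]

theorem exists_sum_drift_le {p : ℝ} (hp : 0 < p) : ∃ C : ℝ, 0 < C ∧ ∀ (n : ℕ) (L : ℝ),
    1 ≤ n → 1 ≤ L →
    (∀ k, 1 ≤ k → k ≤ n → elephantV p k ≤ L * √(k : ℝ) ∧ elephantA p k ^ 2 ≤ L) →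
    (∑ k ∈ Finset.range n, elephantA p (k + 1) ^ 2 * elephantDrift p k) / elephantV p n +
      (∑ k ∈ Finset.range n, elephantA p (k + 1) ^ 4) / elephantV p n ^ 2 ≤
      C * (L / elephantV p n) := by
  set r := 1 + 1 / (2 * p) with hr
  have hr0 : 0 < r := by positivity
  have hsum : Summable fun k : ℕ => (k : ℝ) ^ (-(3 / 2) : ℝ) :=
    Real.summable_nat_rpow.2 (by norm_num)
  set Z := ∑' k : ℕ, (k : ℝ) ^ (-(3 / 2) : ℝ) with hZ
  have hpn : ∀ k : ℕ, 0 ≤ (k : ℝ) ^ (-(3 / 2) : ℝ) := fun k => by positivity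
  have hZ0 : 0 ≤ Z := tsum_nonneg hpn
  refine ⟨2 + r ^ 2 * Z, by positivity, fun n L hn hL h => ?_⟩
  have hv0 : 0 < elephantV p n := by linarith [one_le_elephantV hp hn]
  have hL0 : 0 < L := by linarith
  have h1 : ∑ k ∈ Finset.range n, elephantA p (k + 1) ^ 2 * elephantDrift p k ≤
      L + r ^ 2 * L * Z := by
    calc _ ≤ ∑ k ∈ Finset.range n,
          ((if k = 0 then L else 0) + r ^ 2 * L * (k : ℝ) ^ (-(3 / 2) : ℝ)) := by
          refine Finset.sum_le_sum fun k hk => ?_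
          rcases Nat.eq_zero_or_pos k with rfl | hk0
          · simp only [elephantDrift, if_true, zero_add, elephantA_one p hp]
            have := mul_nonneg (mul_nonneg (sq_nonneg r) hL0.le) (hpn 0)
            linarith
          · have hkn : k ≤ n := (Finset.mem_range.1 hk).le
            have hkr : (0 : ℝ) < k := by exact_mod_cast hk0
            have ha := elephantA_pos hp hk0
            have ha1 := elephantA_pos hp (show 1 ≤ k + 1 by omega)
            rw [elephantDrift, if_neg (by omega), if_neg (by omega), zero_add]
            have h3 := (h k hk0 hkn).1
            have hvk : 0 ≤ elephantV p k := by linarith [one_le_elephantV hp hk0]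
            have e : √(k : ℝ) / (k : ℝ) ^ 2 = (k : ℝ) ^ (-(3 / 2) : ℝ) := by
              rw [Real.sqrt_eq_rpow, ← Real.rpow_natCast, ← Real.rpow_sub hkr]
              norm_num
            rw [← e, mul_pow]
            have h4 : elephantA p (k + 1) ^ 2 ≤ (r * elephantA p k) ^ 2 := by
              gcongr
              exact elephantA_succ_le hp hk0
            calc _ ≤ (r * elephantA p k) ^ 2 *
                  (L * √(k : ℝ) / (elephantA p k ^ 2 * (k : ℝ) ^ 2)) := by gcongr
              _ = _ := by field_simp
      _ ≤ _ := by
          rw [Finset.sum_add_distrib, ← Finset.mul_sum]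
          gcongr
          · rw [Finset.sum_ite_eq']
            split_ifs <;> linarith
          · exact hsum.sum_le_tsum _ fun k _ => hpn k
  have h2 : ∑ k ∈ Finset.range n, elephantA p (k + 1) ^ 4 ≤ L * elephantV p n := by
    rw [← sum_range_elephantA_sq, Finset.mul_sum]
    refine Finset.sum_le_sum fun k hk => ?_
    have := (h (k + 1) (by omega) (Finset.mem_range.1 hk)).2
    nlinarith [sq_nonneg (elephantA p (k + 1))]
  calc _ ≤ (L + r ^ 2 * L * Z) / elephantV p n + L * elephantV p n / elephantV p n ^ 2 := by
        gcongr
    _ = _ := by field_simp; ring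

theorem elephantA_succ_mul_sqrt_drift_le {p : ℝ} (hp : 0 < p) {k n : ℕ} (hkn : k < n) :
    elephantA p (k + 1) * √(elephantDrift p k) ≤
      √(elephantV p n) * (2 * (1 + 1 / (2 * p)) / (k + 1)) := by
  set r := 1 + 1 / (2 * p) with hr
  have hr1 : 1 ≤ r := by rw [hr]; linarith [show 0 < 1 / (2 * p) by positivity]
  have hs1 : 1 ≤ √(elephantV p n) := Real.one_le_sqrt.2 (one_le_elephantV hp (by omega))
  rcases Nat.eq_zero_or_pos k with rfl | hk0
  · simp only [elephantDrift, if_true, zero_add, elephantA_one p hp]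
    simp
    nlinarith
  · have hkr : (1 : ℝ) ≤ k := by exact_mod_cast hk0
    have ha := elephantA_pos hp hk0
    rw [elephantDrift, if_neg (by omega), Real.sqrt_div' _ (by positivity),
      Real.sqrt_sq (by positivity)]
    calc _ ≤ r * elephantA p k * (√(elephantV p n) / (elephantA p k * k)) := by
          gcongr
          · exact elephantA_succ_le hp hk0
          · exact elephantV_mono p hkn.le
      _ = √(elephantV p n) * (r / k) := by field_simp
      _ ≤ √(elephantV p n) * (2 * r / (k + 1)) := by
          gcongr ?_ * ?_
          rw [div_le_div_iff₀ (by linarith) (by linarith)]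
          nlinarith

/-- The walk below the critical memory parameter. -/
theorem exists_kolmogorovDist_le_of_lt {p : ℝ} (hp : 0 < p) (hp' : p < 3 / 4) :
    ∃ C : ℝ, 0 < C ∧ ∀ (Ω : Type*) [MeasurableSpace Ω] (μ : Measure Ω) [IsProbabilityMeasure μ]
      (q : ℝ) (X α : ℕ → Ω → ℝ) (β : ℕ → Ω → ℕ) (_ : IsElephantWalk μ p q X α β)
      (_ : 0 ≤ q) (_ : q ≤ 1) (n : ℕ) (L : ℝ) (_ : 1 ≤ n) (_ : 1 ≤ L)
      (_ : ∀ k, 1 ≤ k → k ≤ n → elephantV p k ≤ L * √(k : ℝ) ∧ elephantA p k ^ 2 ≤ L),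
      kolmogorovDist μ (fun ω =>
          (elephantA p n * elephantPosition X n ω - (2 * q - 1)) / √(elephantV p n)) ≤
        C * (L / elephantV p n + 1 / √(n : ℝ)) := by
  obtain ⟨C₀, hC₀, H₀⟩ := exists_kolmogorovDist_elephant_le
  obtain ⟨C₃, hC₃, H₃⟩ := exists_sum_drift_le hp
  obtain ⟨c₁, C₁, hc₁, hC₁, h₁⟩ := exists_elephantA_sq_bounds hp
  obtain ⟨c₂, C₂, hc₂, hC₂, h₂⟩ := exists_elephantV_bounds hp hp'
  set γ := 3 - 4 * p with hγ
  have hγ0 : 0 < γ := by linarith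
  have eγ : 2 - 4 * p = γ - 1 := by rw [hγ]; ring
  rw [eγ] at h₁
  set r := 1 + 1 / (2 * p) with hr
  have hr0 : 0 < r := by positivity
  set D := 1 + 2 * (C₂ / c₁) with hD
  have hD0 : 0 < D := by positivity
  have hdrift : ∀ k : ℕ, elephantDrift p k ≤ D / (k + 1) := by
    intro k
    rcases Nat.eq_zero_or_pos k with rfl | hk0
    · simp only [elephantDrift, if_true]
      simp
      linarith [show 0 < C₂ / c₁ by positivity]
    · have hkr : (1 : ℝ) ≤ k := by exact_mod_cast hk0
      have hkp : (0 : ℝ) < k := by linarith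
      have ha := elephantA_pos hp hk0
      have hpw : (0 : ℝ) < (k : ℝ) ^ γ := Real.rpow_pos_of_pos hkp _
      rw [elephantDrift, if_neg (by omega), mul_pow]
      have h1 := (h₁ k hk0).1
      rw [Real.rpow_sub_one hkp.ne'] at h1
      calc _ ≤ C₂ * (k : ℝ) ^ γ / (c₁ * ((k : ℝ) ^ γ / k) * (k : ℝ) ^ 2) := by
            gcongr
            exact (h₂ k).2
        _ = C₂ / c₁ / k := by field_simp
        _ ≤ D / (k + 1) := by
            rw [div_le_div_iff₀ hkp (by linarith)]
            have := show 0 < C₂ / c₁ by positivity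
            nlinarith
  obtain ⟨R, hR1, hR⟩ : ∃ R : ℕ, 1 ≤ R ∧ 2 * C₂ / c₂ ≤ (R : ℝ) ^ γ := by
    have ht : Tendsto (fun R : ℕ => (R : ℝ) ^ γ) atTop atTop :=
      (tendsto_rpow_atTop hγ0).comp tendsto_natCast_atTop_atTop
    exact ((eventually_ge_atTop 1).and (ht.eventually_ge_atTop _)).exists
  have hRr : (1 : ℝ) ≤ R := by exact_mod_cast hR1
  have hR0 : (0 : ℝ) < R := by linarith
  set t₀ := √(c₂ / (C₁ * R)) with ht₀
  have ht₀0 : 0 < t₀ := Real.sqrt_pos.2 (by positivity)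
  refine ⟨C₀ * (C₃ + (D + 2 * r) * R * t₀ + 1 / t₀), by positivity, ?_⟩
  intro Ω _ μ _ q X α β hw hq hq1 n L hn hL hnL
  have hnr : (1 : ℝ) ≤ n := by exact_mod_cast hn
  have hn0 : (0 : ℝ) < n := by linarith
  have hsn : 0 < √(n : ℝ) := Real.sqrt_pos.2 hn0
  have hv0 : 0 < elephantV p n := by linarith [one_le_elephantV hp hn]
  have hkR : ∀ k : ℕ, n / R ≤ k → (n : ℝ) ≤ (k + 1) * R := by
    intro k hk
    have : n < (k + 1) * R := (Nat.div_lt_iff_lt_mul hR1).1 (by omega)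
    exact_mod_cast this.le
  have hinv : ∀ k : ℕ, n / R ≤ k → (1 : ℝ) / (k + 1) ≤ R / n := by
    intro k hk
    rw [div_le_div_iff₀ (by positivity) hn0]
    linarith [hkR k hk]
  have key := H₀ Ω μ p q X α β hw hp (by linarith) hq hq1 n (n / R) hn (Nat.div_le_self _ _) (by
      have h1 := (h₂ (n / R)).2
      have h2 := (h₂ n).1
      have h3 : ((n / R : ℕ) : ℝ) ^ γ ≤ ((n : ℝ) / R) ^ γ := by
        gcongr
        exact Nat.cast_div_le
      rw [Real.div_rpow hn0.le hR0.le] at h3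
      have hnp : 0 < (n : ℝ) ^ γ := Real.rpow_pos_of_pos hn0 _
      have hRp : 0 < (R : ℝ) ^ γ := Real.rpow_pos_of_pos hR0 _
      have h4 : C₂ * ((n : ℝ) ^ γ / (R : ℝ) ^ γ) ≤ c₂ * (n : ℝ) ^ γ / 2 := by
        rw [← mul_div_assoc, div_le_iff₀ hRp]
        rw [div_le_iff₀ hc₂] at hR
        nlinarith
      calc _ ≤ _ := h1
        _ ≤ C₂ * ((n : ℝ) ^ γ / (R : ℝ) ^ γ) := by gcongr
        _ ≤ _ := h4
        _ ≤ _ := by linarith)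
    (t₀ * √(n : ℝ)) ((D + 2 * r) * (R / n)) (by positivity) (by positivity)
    (fun k hk hkn => by
      have hk1 : (0 : ℝ) < ((k + 1 : ℕ) : ℝ) := by positivity
      refine Real.le_sqrt_of_sq_le ?_
      rw [mul_pow, mul_pow, Real.sq_sqrt hn0.le, ht₀, Real.sq_sqrt (by positivity)]
      have h1 := (h₁ (k + 1) (by omega)).2
      have h3 : ((k + 1 : ℕ) : ℝ) ^ (γ - 1) ≤ (n : ℝ) ^ γ * (R / n) := by
        rw [Real.rpow_sub_one hk1.ne', div_eq_mul_one_div]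
        gcongr ?_ * ?_
        · gcongr
          exact_mod_cast hkn
        · have := hinv k hk
          push_cast
          exact this
      calc _ ≤ c₂ / (C₁ * R) * n * (C₁ * ((n : ℝ) ^ γ * (R / n))) := by
            gcongr
            exact h1.trans (by gcongr)
        _ = c₂ * (n : ℝ) ^ γ := by field_simp
        _ ≤ _ := (h₂ n).1)
    (fun k hk hkn => by
      have h1 := hinv k hk
      constructor
      · refine (hdrift k).trans ?_
        calc D / (k + 1) = D * (1 / (k + 1)) := by ring
          _ ≤ (D + 2 * r) * (R / n) := by gcongr; linarith
      · refine (elephantA_succ_mul_sqrt_drift_le hp hkn).trans ?_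
        gcongr ?_ * ?_
        calc 2 * r / ((k : ℝ) + 1) = 2 * r * (1 / (k + 1)) := by ring
          _ ≤ (D + 2 * r) * (R / n) := by gcongr; linarith)
  refine key.trans ?_
  have h5 := H₃ n L hn hL hnL
  have hLv : 0 < L / elephantV p n := by positivity
  have e1 : (D + 2 * r) * (R / n) * (t₀ * √(n : ℝ)) = (D + 2 * r) * R * t₀ * (1 / √(n : ℝ)) := by
    have := Real.sq_sqrt hn0.le
    field_simp
    rw [this]
  have e2 : 1 / (t₀ * √(n : ℝ)) = 1 / t₀ * (1 / √(n : ℝ)) := by field_simp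
  rw [e1, e2, mul_assoc C₀]
  gcongr
  have h6 : 0 < 1 / √(n : ℝ) := by positivity
  have h7 : 0 < (D + 2 * r) * R * t₀ := by positivity
  have h8 : 0 < 1 / t₀ := by positivity
  nlinarith [mul_pos hC₃ h6, mul_pos h7 hLv, mul_pos h8 hLv]

/-- The walk at the critical memory parameter. -/
theorem exists_kolmogorovDist_le_critical :
    ∃ C : ℝ, 0 < C ∧ ∀ (Ω : Type*) [MeasurableSpace Ω] (μ : Measure Ω) [IsProbabilityMeasure μ]
      (q : ℝ) (X α : ℕ → Ω → ℝ) (β : ℕ → Ω → ℕ) (_ : IsElephantWalk μ (3 / 4) q X α β)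
      (_ : 0 ≤ q) (_ : q ≤ 1) (n : ℕ) (_ : 1 ≤ n),
      kolmogorovDist μ (fun ω =>
          (elephantA (3 / 4) n * elephantPosition X n ω - (2 * q - 1)) /
            √(elephantV (3 / 4) n)) ≤
        C * (1 / elephantV (3 / 4) n) := by
  have hp : (0 : ℝ) < 3 / 4 := by norm_num
  obtain ⟨C₀, hC₀, H₀⟩ := exists_kolmogorovDist_elephant_le
  obtain ⟨C₃, hC₃, H₃⟩ := exists_sum_drift_le hp
  obtain ⟨c₁, C₁, hc₁, hC₁, h₁⟩ := exists_elephantA_sq_bounds hp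
  obtain ⟨c₂, C₂, hc₂, hC₂, h₂⟩ := exists_elephantV_log_bounds
  have e : (2 - 4 * (3 / 4) : ℝ) = -1 := by norm_num
  rw [e] at h₁
  simp_rw [Real.rpow_neg_one] at h₁
  set r : ℝ := 1 + 1 / (2 * (3 / 4)) with hr
  have hr0 : 0 < r := by positivity
  set ε := c₂ / (4 * C₂) with hε
  have hε0 : 0 < ε := by positivity
  have hlogpow : ∀ δ : ℝ, 0 < δ → ∀ n : ℕ, 1 ≤ n →
      elephantV (3 / 4) n ≤ C₂ * (1 + 1 / δ) * (n : ℝ) ^ δ := by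
    intro δ hδ n hn
    have hnr : (1 : ℝ) ≤ n := by exact_mod_cast hn
    have h1 := Real.log_natCast_le_rpow_div n hδ
    have h2 := Real.one_le_rpow hnr hδ.le
    calc _ ≤ C₂ * (1 + Real.log n) := (h₂ n).2
      _ ≤ C₂ * ((n : ℝ) ^ δ + (n : ℝ) ^ δ / δ) := by gcongr
      _ = _ := by ring
  set A := C₂ * (1 + 1 / (ε / 3)) with hA
  have hA0 : 0 < A := by positivity
  set D := 1 + 2 / c₁ + 2 * r with hD
  have hD0 : 0 < D := by positivity
  set t₀ := √(1 / (C₁ * A)) with ht₀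
  have ht₀0 : 0 < t₀ := Real.sqrt_pos.2 (by positivity)
  obtain ⟨N, hN⟩ : ∃ N : ℕ, ∀ n : ℕ, N ≤ n → C₂ ≤ c₂ / 4 * Real.log n := by
    have ht : Tendsto (fun n : ℕ => c₂ / 4 * Real.log n) atTop atTop :=
      (Real.tendsto_log_atTop.comp tendsto_natCast_atTop_atTop).const_mul_atTop (by positivity)
    exact eventually_atTop.1 (ht.eventually_ge_atTop _)
  set L := 1 + C₁ + C₂ * 3 with hL
  refine ⟨C₀ * (C₃ * L + D * t₀ * A ^ 3 + 1 / t₀) + elephantV (3 / 4) (N + 1), by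
    have := one_le_elephantV hp (show 1 ≤ N + 1 by omega)
    positivity, ?_⟩
  intro Ω _ μ _ q X α β hw hq hq1 n hn
  have hv1 : 1 ≤ elephantV (3 / 4) n := one_le_elephantV hp hn
  have hv0 : 0 < elephantV (3 / 4) n := by linarith
  have hvi : 0 < 1 / elephantV (3 / 4) n := by positivity
  have hX : 0 < C₀ * (C₃ * L + D * t₀ * A ^ 3 + 1 / t₀) := by positivity
  rw [add_mul]
  rcases lt_or_ge n N with hnN | hnN
  · have hm : Measurable fun ω => (elephantA (3 / 4) n * elephantPosition X n ω - (2 * q - 1)) /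
        √(elephantV (3 / 4) n) :=
      (((hw.measurable_position n).const_mul _).sub_const _).div_const _
    refine (kolmogorovDist_le_one hm).trans ?_
    have h1 := elephantV_mono (3 / 4) (show n ≤ N + 1 by omega)
    have h2 : 1 ≤ elephantV (3 / 4) (N + 1) * (1 / elephantV (3 / 4) n) := by
      rw [mul_one_div, one_le_div hv0]
      exact h1
    nlinarith [mul_pos hX hvi]
  have hnr : (1 : ℝ) ≤ n := by exact_mod_cast hn
  have hn0 : (0 : ℝ) < n := by linarith
  have hpow1 : 1 ≤ (n : ℝ) ^ ε := Real.one_le_rpow hnr hε0.le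
  have hpow0 : 0 < (n : ℝ) ^ ε := by linarith
  have hvA : elephantV (3 / 4) n ^ 3 ≤ A ^ 3 * (n : ℝ) ^ ε := by
    have h1 := hlogpow (ε / 3) (by positivity) n hn
    have h2 : ((n : ℝ) ^ (ε / 3)) ^ 3 = (n : ℝ) ^ ε := by
      rw [← Real.rpow_natCast, ← Real.rpow_mul hn0.le]
      congr 1
      push_cast
      ring
    rw [← h2, ← mul_pow]
    gcongr
  have hvA1 : elephantV (3 / 4) n ≤ A * (n : ℝ) ^ ε := by
    refine (hlogpow (ε / 3) (by positivity) n hn).trans ?_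
    gcongr
    linarith
  set K := ⌊(n : ℝ) ^ ε⌋₊ with hK
  have hε1 : ε ≤ 1 := by
    have h1 := (h₂ 3).1.trans (h₂ 3).2
    have h2 : 1 ≤ Real.log (3 : ℕ) := by
      rw [Real.le_log_iff_exp_le (by norm_num)]
      push_cast
      linarith [Real.exp_one_lt_d9]
    have h3 : c₂ ≤ 2 * C₂ := by nlinarith
    rw [hε, div_le_one (by positivity)]
    linarith
  have hKn : K ≤ n := by
    have h1 : (n : ℝ) ^ ε ≤ n := by
      calc _ ≤ (n : ℝ) ^ (1 : ℝ) := by gcongr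
        _ = n := Real.rpow_one _
    exact_mod_cast (Nat.floor_le hpow0.le).trans h1
  have hK1 : 1 ≤ K := (Nat.one_le_floor_iff _).2 hpow1
  have hinv : ∀ k : ℕ, K ≤ k → (1 : ℝ) / (k + 1) ≤ 1 / (n : ℝ) ^ ε := by
    intro k hk
    have h1 := Nat.lt_floor_add_one ((n : ℝ) ^ ε)
    have h2 : ((K : ℕ) : ℝ) ≤ k := by exact_mod_cast hk
    gcongr
    linarith
  have hinvk : ∀ k : ℕ, K ≤ k → (1 : ℝ) / k ≤ 2 * (1 / (n : ℝ) ^ ε) := by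
    intro k hk
    have hk1 : (1 : ℝ) ≤ k := by exact_mod_cast hK1.trans hk
    have h1 := hinv k hk
    have h2 : (1 : ℝ) / k ≤ 2 * (1 / (k + 1)) := by
      rw [mul_one_div, div_le_div_iff₀ (by linarith) (by linarith)]
      linarith
    linarith
  have hsv : √(elephantV (3 / 4) n) ^ 2 = elephantV (3 / 4) n := Real.sq_sqrt hv0.le
  have key := H₀ Ω μ (3 / 4) q X α β hw hp (by norm_num) hq hq1 n K hn hKn (by
      have h1 := (h₂ K).2
      have h2 := (h₂ n).1
      have h3 : Real.log K ≤ ε * Real.log n := by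
        rw [← Real.log_rpow hn0]
        exact Real.log_le_log (by exact_mod_cast hK1) (Nat.floor_le hpow0.le)
      have h4 : C₂ * (ε * Real.log n) = c₂ / 4 * Real.log n := by
        rw [hε]
        field_simp
      have h5 := mul_le_mul_of_nonneg_left h3 hC₂.le
      linarith [hN n hnN])
    (t₀ * elephantV (3 / 4) n) (D * (elephantV (3 / 4) n * (1 / (n : ℝ) ^ ε)))
    (by positivity) (by positivity)
    (fun k hk hkn => by
      refine Real.le_sqrt_of_sq_le ?_
      rw [mul_pow, mul_pow, ht₀, Real.sq_sqrt (by positivity)]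
      have h1 := (h₁ (k + 1) (by omega)).2
      have h2 := hinv k hk
      have h3 : (((k + 1 : ℕ) : ℝ))⁻¹ ≤ 1 / (n : ℝ) ^ ε := by
        rw [← one_div]
        push_cast
        exact h2
      calc _ ≤ 1 / (C₁ * A) * elephantV (3 / 4) n ^ 2 * (C₁ * (1 / (n : ℝ) ^ ε)) := by
            gcongr
            exact h1.trans (by gcongr)
        _ = elephantV (3 / 4) n * (elephantV (3 / 4) n / (A * (n : ℝ) ^ ε)) := by field_simp
        _ ≤ elephantV (3 / 4) n * 1 := by
            gcongr
            rw [div_le_one (by positivity)]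
            exact hvA1
        _ = _ := mul_one _)
    (fun k hk hkn => by
      have hk1 : 1 ≤ k := hK1.trans hk
      have hkr : (0 : ℝ) < k := by exact_mod_cast hk1
      have ha := elephantA_pos hp hk1
      have hpn : 0 < 1 / (n : ℝ) ^ ε := by positivity
      constructor
      · rw [elephantDrift, if_neg (by omega), mul_pow]
        have h1 := (h₁ k hk1).1
        calc _ ≤ elephantV (3 / 4) n / (c₁ * (k : ℝ)⁻¹ * (k : ℝ) ^ 2) := by
              gcongr
              exact elephantV_mono _ hkn.le
          _ = 1 / c₁ * elephantV (3 / 4) n * (1 / k) := by field_simp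
          _ ≤ 1 / c₁ * elephantV (3 / 4) n * (2 * (1 / (n : ℝ) ^ ε)) := by
              gcongr
              exact hinvk k hk
          _ = 2 / c₁ * (elephantV (3 / 4) n * (1 / (n : ℝ) ^ ε)) := by ring
          _ ≤ _ := by
              gcongr
              rw [hD]
              linarith
      · refine (elephantA_succ_mul_sqrt_drift_le hp hkn).trans ?_
        gcongr ?_ * ?_
        have h2 : 0 < 2 / c₁ := by positivity
        calc 2 * r / ((k : ℝ) + 1) = 2 * r * (1 * (1 / (k + 1))) := by ring
          _ ≤ D * (elephantV (3 / 4) n * (1 / (n : ℝ) ^ ε)) := by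
              gcongr ?_ * (?_ * ?_)
              · rw [hD]
                linarith
              · exact hinv k hk)
  refine key.trans ?_
  have h5 := H₃ n L hn (by rw [hL]; linarith) (fun k hk hkn => by
    have hkr : (1 : ℝ) ≤ k := by exact_mod_cast hk
    constructor
    · refine (hlogpow (1 / 2) (by norm_num) k hk).trans ?_
      rw [← Real.sqrt_eq_rpow]
      gcongr
      rw [hL]
      norm_num
      linarith
    · have h6 : ((k : ℝ))⁻¹ ≤ 1 := inv_le_one_of_one_le₀ hkr
      have h7 := mul_le_mul_of_nonneg_left h6 hC₁.le
      linarith [(h₁ k hk).2])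
  have e1 : D * (elephantV (3 / 4) n * (1 / (n : ℝ) ^ ε)) * (t₀ * elephantV (3 / 4) n) ≤
      D * t₀ * A ^ 3 * (1 / elephantV (3 / 4) n) := by
    have h6 : elephantV (3 / 4) n * (1 / (n : ℝ) ^ ε) * elephantV (3 / 4) n ≤
        A ^ 3 * (1 / elephantV (3 / 4) n) := by
      rw [mul_one_div, mul_one_div, div_mul_eq_mul_div, div_le_div_iff₀ hpow0 hv0]
      linarith
    have h7 : 0 < D * t₀ := by positivity
    have h8 := mul_le_mul_of_nonneg_left h6 h7.le
    linarith
  have e2 : 1 / (t₀ * elephantV (3 / 4) n) = 1 / t₀ * (1 / elephantV (3 / 4) n) := by field_simp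
  have e3 : C₃ * (L / elephantV (3 / 4) n) = C₃ * L * (1 / elephantV (3 / 4) n) := by ring
  have h9 : 0 < elephantV (3 / 4) (N + 1) * (1 / elephantV (3 / 4) n) := by
    have := one_le_elephantV hp (show 1 ≤ N + 1 by omega)
    positivity
  rw [e3] at h5
  rw [e2, mul_assoc C₀]
  refine le_trans ?_ (le_add_of_nonneg_right h9.le)
  gcongr
  linarith

theorem exists_kolmogorovDist_le_rate {p : ℝ} (hp : 0 < p) (hp' : p ≤ 3 / 4) :
    ∃ C : ℝ, 0 < C ∧ ∀ (Ω : Type*) [MeasurableSpace Ω] (μ : Measure Ω) [IsProbabilityMeasure μ]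
      (q : ℝ) (X α : ℕ → Ω → ℝ) (β : ℕ → Ω → ℕ) (_ : IsElephantWalk μ p q X α β)
      (_ : 0 ≤ q) (_ : q ≤ 1) (n : ℕ) (_ : 1 ≤ n),
      kolmogorovDist μ (fun ω =>
          (elephantA p n * elephantPosition X n ω - (2 * q - 1)) / √(elephantV p n)) ≤
        C * (if p ≤ 5 / 8 then 1 / √(n : ℝ) else 1 / elephantV p n) := by
  rcases eq_or_lt_of_le hp' with rfl | hlt
  · simp only [if_neg (show ¬((3 / 4 : ℝ) ≤ 5 / 8) by norm_num)]
    exact exists_kolmogorovDist_le_critical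
  obtain ⟨C₀, hC₀, H₀⟩ := exists_kolmogorovDist_le_of_lt hp hlt
  obtain ⟨c₁, C₁, hc₁, hC₁, h₁⟩ := exists_elephantA_sq_bounds hp
  obtain ⟨c₂, C₂, hc₂, hC₂, h₂⟩ := exists_elephantV_bounds hp hlt
  set γ := 3 - 4 * p with hγ
  have hγ0 : 0 < γ := by linarith
  have eγ : 2 - 4 * p = γ - 1 := by rw [hγ]; ring
  rw [eγ] at h₁
  split_ifs with h58
  · have hγ2 : 0 ≤ γ - 1 / 2 := by linarith
    refine ⟨C₀ * ((1 + C₁ + C₂) / c₂ + 1), by positivity, ?_⟩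
    intro Ω _ μ _ q X α β hw hq hq1 n hn
    have hnr : (1 : ℝ) ≤ n := by exact_mod_cast hn
    have hn0 : (0 : ℝ) < n := by linarith
    have hP1 : 1 ≤ (n : ℝ) ^ (γ - 1 / 2) := Real.one_le_rpow hnr hγ2
    have key := H₀ Ω μ q X α β hw hq hq1 n ((1 + C₁ + C₂) * (n : ℝ) ^ (γ - 1 / 2)) hn
      (by nlinarith) (fun k hk hkn => by
        have hkr : (1 : ℝ) ≤ k := by exact_mod_cast hk
        have hk0 : (0 : ℝ) < k := by linarith
        have hkn' : (k : ℝ) ≤ n := by exact_mod_cast hkn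
        have h3 : (k : ℝ) ^ (γ - 1 / 2) ≤ (n : ℝ) ^ (γ - 1 / 2) := by gcongr
        constructor
        · have e : (k : ℝ) ^ γ = (k : ℝ) ^ (γ - 1 / 2) * √(k : ℝ) := by
            rw [Real.sqrt_eq_rpow, ← Real.rpow_add hk0]
            congr 1
            ring
          calc _ ≤ C₂ * ((k : ℝ) ^ (γ - 1 / 2) * √(k : ℝ)) := by rw [← e]; exact (h₂ k).2
            _ ≤ (1 + C₁ + C₂) * ((n : ℝ) ^ (γ - 1 / 2) * √(k : ℝ)) := by gcongr; linarith
            _ = _ := by ring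
        · calc _ ≤ C₁ * (k : ℝ) ^ (γ - 1) := (h₁ k hk).2
            _ ≤ C₁ * (k : ℝ) ^ (γ - 1 / 2) := by
                gcongr
                norm_num
            _ ≤ (1 + C₁ + C₂) * (n : ℝ) ^ (γ - 1 / 2) := by gcongr; linarith)
    refine key.trans ?_
    rw [mul_assoc]
    gcongr
    rw [add_mul _ 1, one_mul]
    gcongr
    have hpw : 0 < (n : ℝ) ^ γ := Real.rpow_pos_of_pos hn0 _
    calc _ ≤ (1 + C₁ + C₂) * (n : ℝ) ^ (γ - 1 / 2) / (c₂ * (n : ℝ) ^ γ) := by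
          gcongr
          exact (h₂ n).1
      _ = _ := by
          rw [Real.rpow_sub hn0, Real.sqrt_eq_rpow]
          field_simp
  · have hγ2 : γ ≤ 1 / 2 := by linarith
    refine ⟨C₀ * (1 + C₁ + C₂ + C₂), by positivity, ?_⟩
    intro Ω _ μ _ q X α β hw hq hq1 n hn
    have hv0 : 0 < elephantV p n := by linarith [one_le_elephantV hp hn]
    have hV : ∀ k : ℕ, 1 ≤ k → elephantV p k ≤ C₂ * √(k : ℝ) := by
      intro k hk
      have hkr : (1 : ℝ) ≤ k := by exact_mod_cast hk
      refine (h₂ k).2.trans ?_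
      rw [Real.sqrt_eq_rpow]
      gcongr
    have key := H₀ Ω μ q X α β hw hq hq1 n (1 + C₁ + C₂) hn
      (by linarith) (fun k hk hkn => by
        have hkr : (1 : ℝ) ≤ k := by exact_mod_cast hk
        constructor
        · refine (hV k hk).trans ?_
          gcongr
          linarith
        · have h3 : (k : ℝ) ^ (γ - 1) ≤ 1 := Real.rpow_le_one_of_one_le_of_nonpos hkr (by linarith)
          have h4 := mul_le_mul_of_nonneg_left h3 hC₁.le
          linarith [(h₁ k hk).2])
    refine key.trans ?_
    rw [mul_assoc]
    gcongr
    rw [add_mul (1 + C₁ + C₂)]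
    have hsn : 0 < √(n : ℝ) := Real.sqrt_pos.2 (by exact_mod_cast hn)
    have h3 : 1 / √(n : ℝ) ≤ C₂ * (1 / elephantV p n) := by
      rw [mul_one_div, div_le_div_iff₀ hsn hv0]
      linarith [hV n hn]
    have h4 : (1 + C₁ + C₂) / elephantV p n = (1 + C₁ + C₂) * (1 / elephantV p n) := by ring
    linarith

theorem theorem3 (p q : ℝ) (hp : 0 < p) (hp' : p ≤ 3 / 4) (hq : 0 < q) (hq' : q ≤ 1) :
    ∃ C : ℝ, 0 < C ∧
      ∀ (Ω : Type*) [MeasurableSpace Ω] (μ : Measure Ω) [IsProbabilityMeasure μ]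
        (X α : ℕ → Ω → ℝ) (β : ℕ → Ω → ℕ), IsElephantWalk μ p q X α β →
        ∀ n : ℕ, 1 ≤ n →
          kolmogorovDist μ (fun ω =>
              (elephantA p n * elephantPosition X n ω - (2 * q - 1)) / √(elephantV p n))
            ≤ C * (1 / √(n : ℝ) + 1 / elephantV p n) ∧
          (p ≤ 5 / 8 →
            kolmogorovDist μ (fun ω =>
              (elephantA p n * elephantPosition X n ω - (2 * q - 1)) / √(elephantV p n))
            ≤ C * (1 / √(n : ℝ))) ∧
          (5 / 8 < p →
            kolmogorovDist μ (fun ω =>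
              (elephantA p n * elephantPosition X n ω - (2 * q - 1)) / √(elephantV p n))
            ≤ C * (1 / elephantV p n)) := by
  obtain ⟨C, hC, H⟩ := exists_kolmogorovDist_le_rate hp hp'
  refine ⟨C, hC, fun Ω _ μ _ X α β hw n hn => ?_⟩
  have h := H Ω μ q X α β hw hq.le hq' n hn
  have hn0 : 0 ≤ 1 / √(n : ℝ) := by positivity
  have hv0 : 0 ≤ 1 / elephantV p n := by
    have := one_le_elephantV hp hn
    positivity
  refine ⟨h.trans ?_, fun h58 => ?_, fun h58 => ?_⟩
  · gcongr
    split_ifs <;> linarith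
  · rwa [if_pos h58] at h
  · rwa [if_neg (not_le.2 h58)] at h
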